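/- All spaces and algebras are complex. For a Banach algebra $A$ and $n\ge 0$ let $C^n(A)$ be the Banach space of bounded $(n+1)$-linear functionals $f(a_0,\dots,a_n)$ on $A$, let $\delta^n\colon C^n(A)\to C^{n+1}(A)$ be $$(\delta^n f)(a_0,\dots,a_{n+1})=\sum_{i=0}^{n}(-1)^i f(a_0,\dots,a_ia_{i+1},\dots,a_{n+1})+(-1)^{n+1}f(a_{n+1}a_0,a_1,\dots,a_n),$$ and let $CC^n(A)\subseteq C^n(A)$ be the closed subspace of cyclic cochains, i.e. of those $f$ with $f(a_0,\dots,a_n)=(-1)^n f(a_1,\dots,a_n,a_0)$. The Banach cyclic cohomology group $\mathcal{HC}^n(A)$ is the $n$th cohomology of the complex $(CC^\bullet(A),\delta)$, a seminormed space with the quotient seminorm. A continuous homomorphism $\varphi\colon A\to D$ induces $\varphi^*\colon \mathcal{HC}^n(D)\to\mathcal{HC}^n(A)$, $[f]\mapsto[f(\varphi(\cdot),\dots,\varphi(\cdot))]$. **Proposition 4.7.** Let $A_1$ and $A_2$ be unital Banach algebras, let $Y$ be a unital Banach $A_1$–$A_2$-bimodule (with jointly continuous actions), and let $$\mathcal U=\begin{bmatrix}A_1&Y\\0&A_2\end{bmatrix}$$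 be the triangular matrix algebra with matrix multiplication, made a Banach algebra by any complete submultiplicative norm that induces the product topology of $A_1\times Y\times A_2$ (for instance $\max\{\|r_1\|+\|y\|,\|r_2\|\}$ when the module actions are contractive). Let $p_i\colon\mathcal U\to A_i$ $(i=1,2)$ be the canonical projections $\begin{bmatrix}r_1&y\\0&r_2\end{bmatrix}\mapsto r_i$. Then for every $n\ge 0$ the map $$\mathcal{HC}^n(A_1)\oplus\mathcal{HC}^n(A_2)\to\mathcal{HC}^n(\mathcal U),\qquad (x_1,x_2)\mapsto p_1^*x_1+p_2^*x_2,$$ is a topological isomorphism, that is, a linear bijection that is a homeomorphism. -/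

import Mathlib

open scoped MulOpposite

noncomputable section

/-! # Banach cyclic cohomology -/

namespace BanachCyclic

section Subquotient

variable {V W : Type*} [NormedAddCommGroup V] [NormedSpace ℂ V] [NormedAddCommGroup W]
  [NormedSpace ℂ W]

/-- The quotient `Z / (B ∩ Z)` of subspaces of a normed space, with the quotient seminorm; it is
used for `B ⊆ Z` only. -/
def Subquotient (Z B : Submodule ℂ V) : Type _ := Z ⧸ B.comap Z.subtype

instance (Z B : Submodule ℂ V) : SeminormedAddCommGroup (Subquotient Z B) :=
  inferInstanceAs (SeminormedAddCommGroup (Z ⧸ B.comap Z.subtype))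

instance (Z B : Submodule ℂ V) : NormedSpace ℂ (Subquotient Z B) :=
  inferInstanceAs (NormedSpace ℂ (Z ⧸ B.comap Z.subtype))

/-- The class of an element of `Z`. -/
def Subquotient.mk (Z B : Submodule ℂ V) : Z →ₗ[ℂ] Subquotient Z B :=
  (B.comap Z.subtype).mkQ

/-- The linear map of subquotients that sends the class of `v` to the class of `f v`. -/
def Subquotient.map {Z B : Submodule ℂ V} {Z' B' : Submodule ℂ W} (f : V →ₗ[ℂ] W)
    (hZ : ∀ v ∈ Z, f v ∈ Z') (hB : ∀ v ∈ B, f v ∈ B') :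
    Subquotient Z B →ₗ[ℂ] Subquotient Z' B' :=
  Submodule.mapQ (B.comap Z.subtype) (B'.comap Z'.subtype) (f.restrict hZ)
    fun v hv => hB v hv

theorem Subquotient.map_mk {Z B : Submodule ℂ V} {Z' B' : Submodule ℂ W} (f : V →ₗ[ℂ] W)
    (hZ : ∀ v ∈ Z, f v ∈ Z') (hB : ∀ v ∈ B, f v ∈ B') (v : Z) :
    Subquotient.map f hZ hB (Subquotient.mk Z B v) =
      Subquotient.mk Z' B' ⟨f v, hZ v v.2⟩ := rfl

end Subquotient

section Cochains

variable (A : Type*) [NormedRing A] [NormedAlgebra ℂ A]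

/-- The space of `n`-dimensional cochains of `A`: bounded `(n+1)`-linear functionals
`f (a₀, …, aₙ)` on `A`, with the operator norm. -/
abbrev Cochain (n : ℕ) : Type _ :=
  ContinuousMultilinearMap ℂ (fun _ : Fin (n + 1) => A) ℂ

variable {A}

/-- Changing one entry of a tuple changes one entry of the tuple with the `i`-th and `(i+1)`-st
entries multiplied, linearly in the changed entry. -/
theorem contractNth_update {n : ℕ} (i : Fin (n + 1)) (a : Fin (n + 2) → A) (m : Fin (n + 2)) :
    ∃ (k : Fin (n + 1)) (L : A →ₗ[ℂ] A), ∀ x,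
      i.castSucc.contractNth (· * ·) (Function.update a m x) =
        Function.update (i.castSucc.contractNth (· * ·) a) k (L x) := by
  rcases lt_trichotomy (m : ℕ) i with h | h | h
  · refine ⟨⟨m, by omega⟩, LinearMap.id, fun x => funext fun k => ?_⟩
    simp only [Fin.contractNth, Function.update_apply, Fin.ext_iff, Fin.val_castSucc,
      Fin.val_succ, LinearMap.id_coe, id_eq]
    split_ifs <;> first | rfl | (exfalso; omega)
  · refine ⟨i, LinearMap.mulRight ℂ (a i.succ), fun x => funext fun k => ?_⟩
    simp only [Fin.contractNth, Function.update_apply, Fin.ext_iff, Fin.val_castSucc,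
      Fin.val_succ, LinearMap.mulRight_apply]
    split_ifs with h1 h2 h3 h4 h5 h6 <;> first | rfl | (exfalso; omega) | skip
    all_goals
      have hk : k = i := Fin.ext (by omega)
      subst hk; rfl
  · by_cases h' : (m : ℕ) = i + 1
    · refine ⟨i, LinearMap.mulLeft ℂ (a i.castSucc), fun x => funext fun k => ?_⟩
      simp only [Fin.contractNth, Function.update_apply, Fin.ext_iff, Fin.val_castSucc,
        Fin.val_succ, LinearMap.mulLeft_apply]
      split_ifs with h1 h2 h3 h4 h5 h6 <;> first | rfl | (exfalso; omega) | skip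
      all_goals
        have hk : k = i := Fin.ext (by omega)
        subst hk; rfl
    · refine ⟨⟨m - 1, by omega⟩, LinearMap.id, fun x => funext fun k => ?_⟩
      simp only [Fin.contractNth, Function.update_apply, Fin.ext_iff, Fin.val_castSucc,
        Fin.val_succ, LinearMap.id_coe, id_eq]
      split_ifs <;> first | rfl | (exfalso; omega)

/-- The cochain `(a₀, …, aₙ₊₁) ↦ f (a₀, …, aᵢ aᵢ₊₁, …, aₙ₊₁)`, for `0 ≤ i ≤ n`. -/
def face {n : ℕ} (i : Fin (n + 1)) (f : Cochain A n) : Cochain A (n + 1) where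
  toFun a := f (i.castSucc.contractNth (· * ·) a)
  map_update_add' := by
    intro inst a m x y
    obtain rfl : inst = instDecidableEqFin _ := Subsingleton.elim _ _
    obtain ⟨k, L, h⟩ := contractNth_update i a m
    simp only [h, map_add, f.map_update_add]
  map_update_smul' := by
    intro inst a m c x
    obtain rfl : inst = instDecidableEqFin _ := Subsingleton.elim _ _
    obtain ⟨k, L, h⟩ := contractNth_update i a m
    simp only [h, map_smul, f.map_update_smul]
  cont := by
    refine f.cont.comp (continuous_pi fun k => ?_)
    unfold Fin.contractNth
    split_ifs <;> fun_prop

/-- The cochain `(a₀, …, aₙ₊₁) ↦ f (aₙ₊₁ a₀, a₁, …, aₙ)`; `finRotate` is `k ↦ k + 1` modulo the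
length. -/
def lastFace {n : ℕ} (f : Cochain A n) : Cochain A (n + 1) :=
  (face 0 f).domDomCongr (finRotate (n + 2)).symm

theorem face_apply {n : ℕ} (i : Fin (n + 1)) (f : Cochain A n) (a : Fin (n + 2) → A) :
    face i f a = f (i.castSucc.contractNth (· * ·) a) := rfl

theorem lastFace_apply {n : ℕ} (f : Cochain A n) (a : Fin (n + 2) → A) :
    lastFace f a =
      f (Fin.cons (a (Fin.last (n + 1)) * a 0) fun k : Fin n => a k.succ.castSucc) := by
  have h0 : (finRotate (n + 2)).symm 0 = Fin.last (n + 1) := by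
    rw [Equiv.symm_apply_eq, finRotate_last]
  have h1 : ∀ k : Fin (n + 1), (finRotate (n + 2)).symm k.succ = k.castSucc := by
    intro k
    rw [Equiv.symm_apply_eq, finRotate_apply, Fin.coeSucc_eq_succ]
  have key : (Fin.castSucc (0 : Fin (n + 1))).contractNth (· * ·)
      (fun k => a ((finRotate (n + 2)).symm k)) =
      Fin.cons (a (Fin.last (n + 1)) * a 0) fun k : Fin n => a k.succ.castSucc := by
    funext k
    refine Fin.cases ?_ (fun k => ?_) k
    · rw [Fin.contractNth_apply_of_eq _ _ _ _ (by simp), h1]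
      simp [h0]
    · rw [Fin.contractNth_apply_of_gt _ _ _ _ (by simp), h1]
      simp
  rw [← key]
  rfl

/-- The coboundary operator
`(δⁿ f) (a₀, …, aₙ₊₁) = ∑_{i=0}^{n} (-1)ⁱ f (a₀, …, aᵢ aᵢ₊₁, …, aₙ₊₁)
  + (-1)ⁿ⁺¹ f (aₙ₊₁ a₀, a₁, …, aₙ)`. -/
def coboundary (n : ℕ) : Cochain A n →ₗ[ℂ] Cochain A (n + 1) where
  toFun f := ∑ i : Fin (n + 1), (-1 : ℂ) ^ (i : ℕ) • face i f + (-1 : ℂ) ^ (n + 1) • lastFace f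
  map_add' f g := by
    have h : ∀ i : Fin (n + 1), face i (f + g) = face i f + face i g := fun _ => rfl
    have h' : lastFace (f + g) = lastFace f + lastFace g := rfl
    simp only [h, h', smul_add, Finset.sum_add_distrib]
    abel
  map_smul' c f := by
    have h : ∀ i : Fin (n + 1), face i (c • f) = c • face i f := fun _ => rfl
    have h' : lastFace (c • f) = c • lastFace f := rfl
    simp only [h, h', smul_add, Finset.smul_sum, smul_comm c, RingHom.id_apply]

theorem coboundary_apply {n : ℕ} (f : Cochain A n) (a : Fin (n + 2) → A) :
    coboundary n f a =
      ∑ i : Fin (n + 1), (-1 : ℂ) ^ (i : ℕ) * f (i.castSucc.contractNth (· * ·) a) +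
        (-1 : ℂ) ^ (n + 1) *
          f (Fin.cons (a (Fin.last (n + 1)) * a 0) fun k : Fin n => a k.succ.castSucc) := by
  simp only [coboundary, LinearMap.coe_mk, AddHom.coe_mk, add_apply, sum_apply, smul_apply,
    smul_eq_mul, face_apply, lastFace_apply]

variable (A)

/-- The cyclic cochains: those `f` with `f (a₀, …, aₙ) = (-1)ⁿ f (a₁, …, aₙ, a₀)`. Indices are
taken in `Fin (n + 1)`, so that `n + 1 = 0`. -/
def cyclicCochains (n : ℕ) : Submodule ℂ (Cochain A n) where
  carrier := {f | ∀ a : Fin (n + 1) → A, (-1 : ℂ) ^ n * f (fun k => a (k + 1)) = f a}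
  add_mem' {f g} hf hg a := by
    simp only [add_apply, mul_add, hf a, hg a]
  zero_mem' a := by simp
  smul_mem' c f hf a := by
    simp only [smul_apply, smul_eq_mul, mul_left_comm _ c, hf a]

/-- The cyclic `n`-cocycles: the cyclic cochains `f` with `δⁿ f = 0`. -/
def cyclicCocycles (n : ℕ) : Submodule ℂ (Cochain A n) :=
  cyclicCochains A n ⊓ LinearMap.ker (coboundary n)

/-- The cyclic `n`-coboundaries: the `δⁿ⁻¹ g` with `g` a cyclic `(n-1)`-cochain; only `0` if
`n = 0`. -/
def cyclicCoboundaries : (n : ℕ) → Submodule ℂ (Cochain A n)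
  | 0 => ⊥
  | n + 1 => (cyclicCochains A n).map (coboundary n)

/-- The `n`-dimensional Banach cyclic cohomology group of `A`: cyclic cocycles modulo cyclic
coboundaries, with the quotient seminorm of the operator norm. -/
abbrev HC (n : ℕ) : Type _ :=
  Subquotient (cyclicCocycles A n) (cyclicCoboundaries A n)

end Cochains

section Functoriality

variable {A B : Type*} [NormedRing A] [NormedAlgebra ℂ A] [NormedRing B] [NormedAlgebra ℂ B]

/-- The cochain map `f ↦ ((a₀, …, aₙ) ↦ f (φ a₀, …, φ aₙ))` of a continuous homomorphism `φ`. -/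
def pullback (φ : A →A[ℂ] B) (n : ℕ) : Cochain B n →ₗ[ℂ] Cochain A n where
  toFun f := f.compContinuousLinearMap fun _ => φ.toContinuousLinearMap
  map_add' _ _ := rfl
  map_smul' _ _ := rfl

@[simp]
theorem pullback_apply (φ : A →A[ℂ] B) (n : ℕ) (f : Cochain B n) (a : Fin (n + 1) → A) :
    pullback φ n f a = f (fun k => φ (a k)) := rfl

theorem coboundary_pullback (φ : A →A[ℂ] B) (n : ℕ) (f : Cochain B n) :
    coboundary n (pullback φ n f) = pullback φ (n + 1) (coboundary n f) := by
  ext a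
  have h : ∀ i : Fin (n + 1), (fun k => φ (i.castSucc.contractNth (· * ·) a k)) =
      i.castSucc.contractNth (· * ·) (fun k => φ (a k)) := by
    intro i
    funext k
    simp only [Fin.contractNth]
    split_ifs <;> simp
  have h' : (fun k => φ ((Fin.cons (a (Fin.last (n + 1)) * a 0)
        fun k : Fin n => a k.succ.castSucc : Fin (n + 1) → A) k)) =
      (Fin.cons (φ (a (Fin.last (n + 1))) * φ (a 0))
        fun k : Fin n => φ (a k.succ.castSucc) : Fin (n + 1) → B) := by
    funext k
    refine Fin.cases ?_ (fun k => ?_) k <;> simp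
  simp only [coboundary_apply, pullback_apply, h, h']

theorem pullback_mem_cyclicCochains (φ : A →A[ℂ] B) (n : ℕ) {f : Cochain B n}
    (hf : f ∈ cyclicCochains B n) : pullback φ n f ∈ cyclicCochains A n :=
  fun a => hf fun k => φ (a k)

theorem pullback_mem_cyclicCocycles (φ : A →A[ℂ] B) (n : ℕ) {f : Cochain B n}
    (hf : f ∈ cyclicCocycles B n) : pullback φ n f ∈ cyclicCocycles A n := by
  refine ⟨pullback_mem_cyclicCochains φ n hf.1, ?_⟩
  have h : coboundary n f = 0 := hf.2
  change coboundary n (pullback φ n f) = 0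
  rw [coboundary_pullback, h, map_zero]

theorem pullback_mem_cyclicCoboundaries (φ : A →A[ℂ] B) (n : ℕ) {f : Cochain B n}
    (hf : f ∈ cyclicCoboundaries B n) : pullback φ n f ∈ cyclicCoboundaries A n := by
  cases n with
  | zero =>
    have h0 : f = 0 := hf
    rw [h0, map_zero]
    exact zero_mem _
  | succ n =>
    obtain ⟨g, hg, rfl⟩ := hf
    exact ⟨pullback φ n g, pullback_mem_cyclicCochains φ n hg, coboundary_pullback φ n g⟩

/-- The map `HCⁿ(B) → HCⁿ(A)` induced by a continuous algebra homomorphism `φ : A → B`: it sends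
the class of a cyclic cocycle `f` to the class of `f (φ a₀, …, φ aₙ)`. -/
def HC.map (n : ℕ) (φ : A →A[ℂ] B) : HC B n →ₗ[ℂ] HC A n :=
  Subquotient.map (pullback φ n) (fun _ hf => pullback_mem_cyclicCocycles φ n hf)
    fun _ hf => pullback_mem_cyclicCoboundaries φ n hf

end Functoriality

end BanachCyclic

/-! # Triangular matrix algebras -/

/-- The triangular matrix algebra of matrices `[[r₁, y], [0, r₂]]` with `r₁ ∈ A₁`, `y ∈ Y` and
`r₂ ∈ A₂`, stored as the triple `(r₁, y, r₂)`; addition, scalar multiplication and topology are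
those of the product. -/
def Triangular (A₁ Y A₂ : Type*) : Type _ := A₁ × Y × A₂

set_option linter.unusedSectionVars false

namespace Triangular

section

variable {A₁ Y A₂ : Type*} [NormedRing A₁] [NormedAlgebra ℂ A₁] [NormedRing A₂]
  [NormedAlgebra ℂ A₂] [NormedAddCommGroup Y] [NormedSpace ℂ Y] [Module A₁ Y] [Module A₂ᵐᵒᵖ Y]
  [SMulCommClass A₁ A₂ᵐᵒᵖ Y] [IsScalarTower ℂ A₁ Y] [IsScalarTower ℂ A₂ᵐᵒᵖ Y]

/-- The matrix `[[r₁, y], [0, r₂]]`. -/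
def mk (r₁ : A₁) (y : Y) (r₂ : A₂) : Triangular A₁ Y A₂ := (r₁, y, r₂)

/-- The upper left entry. -/
def e11 (u : Triangular A₁ Y A₂) : A₁ := u.1

/-- The upper right entry. -/
def e12 (u : Triangular A₁ Y A₂) : Y := u.2.1

/-- The lower right entry. -/
def e22 (u : Triangular A₁ Y A₂) : A₂ := u.2.2

instance : AddCommGroup (Triangular A₁ Y A₂) := inferInstanceAs (AddCommGroup (A₁ × Y × A₂))

instance : Module ℂ (Triangular A₁ Y A₂) := inferInstanceAs (Module ℂ (A₁ × Y × A₂))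

instance : TopologicalSpace (Triangular A₁ Y A₂) :=
  inferInstanceAs (TopologicalSpace (A₁ × Y × A₂))

theorem ext {u v : Triangular A₁ Y A₂} (h₁ : u.e11 = v.e11) (h : u.e12 = v.e12)
    (h₂ : u.e22 = v.e22) : u = v :=
  Prod.ext h₁ (Prod.ext h h₂)

/-- Matrix multiplication:
`[[r₁, y], [0, r₂]] [[s₁, z], [0, s₂]] = [[r₁ s₁, r₁ · z + y · s₂], [0, r₂ s₂]]`. -/
instance : Mul (Triangular A₁ Y A₂) where
  mul u v := mk (u.e11 * v.e11) (u.e11 • v.e12 + MulOpposite.op v.e22 • u.e12) (u.e22 * v.e22)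

instance : One (Triangular A₁ Y A₂) where
  one := mk 1 0 1

theorem e11_mul (u v : Triangular A₁ Y A₂) : (u * v).e11 = u.e11 * v.e11 := rfl

theorem e12_mul (u v : Triangular A₁ Y A₂) :
    (u * v).e12 = u.e11 • v.e12 + MulOpposite.op v.e22 • u.e12 := rfl

theorem e22_mul (u v : Triangular A₁ Y A₂) : (u * v).e22 = u.e22 * v.e22 := rfl

theorem e11_add (u v : Triangular A₁ Y A₂) : (u + v).e11 = u.e11 + v.e11 := rfl

theorem e12_add (u v : Triangular A₁ Y A₂) : (u + v).e12 = u.e12 + v.e12 := rfl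

theorem e22_add (u v : Triangular A₁ Y A₂) : (u + v).e22 = u.e22 + v.e22 := rfl

theorem e11_smul (c : ℂ) (u : Triangular A₁ Y A₂) : (c • u).e11 = c • u.e11 := rfl

theorem e12_smul (c : ℂ) (u : Triangular A₁ Y A₂) : (c • u).e12 = c • u.e12 := rfl

theorem e22_smul (c : ℂ) (u : Triangular A₁ Y A₂) : (c • u).e22 = c • u.e22 := rfl

theorem e11_zero : (0 : Triangular A₁ Y A₂).e11 = 0 := rfl

theorem e12_zero : (0 : Triangular A₁ Y A₂).e12 = 0 := rfl

theorem e22_zero : (0 : Triangular A₁ Y A₂).e22 = 0 := rfl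

theorem e11_one : (1 : Triangular A₁ Y A₂).e11 = 1 := rfl

theorem e12_one : (1 : Triangular A₁ Y A₂).e12 = 0 := rfl

theorem e22_one : (1 : Triangular A₁ Y A₂).e22 = 1 := rfl

instance : Ring (Triangular A₁ Y A₂) where
  __ := (inferInstance : AddCommGroup (Triangular A₁ Y A₂))
  mul_assoc u v w := by
    apply ext
    · simp only [e11_mul, mul_assoc]
    · simp only [e11_mul, e12_mul, e22_mul, smul_add, mul_smul, MulOpposite.op_mul, add_assoc,
        smul_comm u.e11 (MulOpposite.op w.e22)]
    · simp only [e22_mul, mul_assoc]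
  one_mul u := by
    apply ext <;> simp [e11_mul, e12_mul, e22_mul, e11_one, e12_one, e22_one]
  mul_one u := by
    apply ext <;> simp [e11_mul, e12_mul, e22_mul, e11_one, e12_one, e22_one]
  left_distrib u v w := by
    apply ext
    · simp only [e11_mul, e11_add, mul_add]
    · simp only [e12_mul, e12_add, e22_add, smul_add, MulOpposite.op_add, add_smul]
      abel
    · simp only [e22_mul, e22_add, mul_add]
  right_distrib u v w := by
    apply ext
    · simp only [e11_mul, e11_add, add_mul]
    · simp only [e12_mul, e12_add, e11_add, smul_add, add_smul]
      abel
    · simp only [e22_mul, e22_add, add_mul]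
  zero_mul u := by
    apply ext <;> simp [e11_mul, e12_mul, e22_mul, e11_zero, e12_zero, e22_zero]
  mul_zero u := by
    apply ext <;> simp [e11_mul, e12_mul, e22_mul, e11_zero, e12_zero, e22_zero]

instance : Algebra ℂ (Triangular A₁ Y A₂) :=
  Algebra.ofModule
    (fun c u v => by
      apply ext
      · simp only [e11_mul, e11_smul, smul_mul_assoc]
      · simp only [e12_mul, e11_smul, e12_smul, smul_add, smul_assoc,
          smul_comm c (MulOpposite.op v.e22)]
      · simp only [e22_mul, e22_smul, smul_mul_assoc])
    (fun c u v => by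
      apply ext
      · simp only [e11_mul, e11_smul, mul_smul_comm]
      · simp only [e12_mul, e22_smul, e12_smul, smul_add, MulOpposite.op_smul, smul_assoc,
          smul_comm c u.e11]
      · simp only [e22_mul, e22_smul, mul_smul_comm])

variable (A₁ Y A₂)

/-- The canonical projection `[[r₁, y], [0, r₂]] ↦ r₁`. -/
def proj₁ : Triangular A₁ Y A₂ →A[ℂ] A₁ where
  toFun u := u.e11
  map_one' := rfl
  map_mul' _ _ := rfl
  map_zero' := rfl
  map_add' _ _ := rfl
  commutes' c := by
    rw [Algebra.algebraMap_eq_smul_one, Algebra.algebraMap_eq_smul_one]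
    rfl
  cont := continuous_fst

/-- The canonical projection `[[r₁, y], [0, r₂]] ↦ r₂`. -/
def proj₂ : Triangular A₁ Y A₂ →A[ℂ] A₂ where
  toFun u := u.e22
  map_one' := rfl
  map_mul' _ _ := rfl
  map_zero' := rfl
  map_add' _ _ := rfl
  commutes' c := by
    rw [Algebra.algebraMap_eq_smul_one, Algebra.algebraMap_eq_smul_one]
    rfl
  cont := continuous_snd.comp continuous_snd

end

end Triangular

end

/-! Let `p` and `q` be the diagonal idempotents of the triangular algebra, so that `p + q = 1` and
`q A p = 0`. Because `q A p = 0`, the compressions `x ↦ p x p` and `x ↦ q x q` are multiplicative,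
and the two diagonal algebras are these corners. The projections followed by pullback along the
corner inclusions give the identity on `HCⁿ(A₁) ⊕ HCⁿ(A₂)`. In the other order, a cocycle `f`
becomes the sum of its two compressions. What must be shown is that `f` minus this sum, a cyclic
cocycle vanishing on both corners, is a cyclic coboundary (`mem_cyclicCoboundaries`).

The cochains vanishing on both corners form a cocyclic subspace. For any cocyclic space over `ℂ`,
acyclicity of the Hochschild complex (`b`) and of the bar complex (`b'`) forces acyclicity of the
cyclic complex, by a chase with `b' (1 - T) = (1 - T) b`, `b N = N b'` and `ker N = im (1 - T)`
(`cyclic_acyclic`).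

The bar complex is contracted by inserting the unit. For the Hochschild complex, inserting `p ⊗ p +
q ⊗ q` between consecutive entries gives a homotopy from the identity to `π₀ ⋯ πₙ`
(`homotopy_succ`). The latter evaluates `f` on tuples whose entries are cut by a cyclic chain of
idempotents. Such a chain is constant or contains a step from `q` to `p`, where the entry lies in `q
A p = 0`. Constant chains give tuples in one corner, so the product kills `f` (`prodπ_eq_zero`).

Both directions of the isomorphism are induced by bounded maps of cochains, so bicontinuity needs no
open mapping argument, although the groups are only seminormed. -/

noncomputable section

/-! ### Cocyclic vector spaces: Hochschild and bar acyclicity imply cyclic acyclicity. -/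

namespace BanachCyclic

/-- A cocyclic vector space, presented by its signed coface maps `D n i = (-1)ⁱ dᵢ`, `i ≤ n + 1`,
and its signed cyclic operators `T n`. -/
structure CocyclicModule (V : ℕ → Type*) [∀ n, AddCommGroup (V n)] [∀ n, Module ℂ (V n)] where
  /-- The signed cofaces. -/
  D : ∀ n, ℕ → V n →ₗ[ℂ] V (n + 1)
  /-- The signed cyclic operators. -/
  T : ∀ n, V n →ₗ[ℂ] V n
  D_D : ∀ n i j, i < j → j ≤ n + 1 → ∀ x, D (n + 1) j (D n i x) = -D (n + 1) i (D n (j - 1) x)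
  T_D_succ : ∀ n i, i ≤ n → ∀ x, T (n + 1) (D n (i + 1) x) = D n i (T n x)
  T_D_zero : ∀ n x, T (n + 1) (D n 0 x) = D n (n + 1) x
  T_pow : ∀ n, T n ^ (n + 1) = 1

namespace CocyclicModule

variable {V : ℕ → Type*} [∀ n, AddCommGroup (V n)] [∀ n, Module ℂ (V n)] (C : CocyclicModule V)

/-- The Hochschild coboundary. -/
def b (n : ℕ) : V n →ₗ[ℂ] V (n + 1) := ∑ i ∈ Finset.range (n + 2), C.D n i

/-- The coboundary of the bar complex. -/
def b' (n : ℕ) : V n →ₗ[ℂ] V (n + 1) := ∑ i ∈ Finset.range (n + 1), C.D n i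

/-- The norm operator `1 + T + ⋯ + Tⁿ`. -/
def N (n : ℕ) : V n →ₗ[ℂ] V n := ∑ k ∈ Finset.range (n + 1), C.T n ^ k

theorem b_apply (n : ℕ) (x : V n) : C.b n x = ∑ i ∈ Finset.range (n + 2), C.D n i x := by
  simp [b]

theorem b'_apply (n : ℕ) (x : V n) : C.b' n x = ∑ i ∈ Finset.range (n + 1), C.D n i x := by
  simp [b']

theorem N_apply (n : ℕ) (x : V n) : C.N n x = ∑ k ∈ Finset.range (n + 1), (C.T n ^ k) x := by
  simp [N]

theorem T_pow_apply (n : ℕ) (x : V n) : (C.T n ^ (n + 1)) x = x := by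
  rw [C.T_pow, Module.End.one_apply]

theorem b_eq (n : ℕ) (x : V n) : C.b n x = C.b' n x + C.D n (n + 1) x := by
  rw [b_apply, b'_apply, Finset.sum_range_succ]

/-- The cofaces, the last one included, satisfy the cosimplicial relations. -/
theorem D_D' (n i j : ℕ) (hij : i < j) (hj : j ≤ n + 2) (x : V n) :
    C.D (n + 1) j (C.D n i x) = -C.D (n + 1) i (C.D n (j - 1) x) := by
  rcases hj.lt_or_eq with h | rfl
  · exact C.D_D n i j hij (by omega) x
  -- Only the case of the last coface `j = n + 2` remains; writing it as `T D₀` reduces it to the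
  -- assumed relations.
  rw [← C.T_D_zero (n + 1)]
  rcases (show i ≤ n + 1 by omega).lt_or_eq with h | rfl
  · have h1 := C.D_D n 0 (i + 1) (by omega) (by omega) x
    rw [Nat.add_sub_cancel] at h1
    have h2 : C.D (n + 1) 0 (C.D n i x) = -C.D (n + 1) (i + 1) (C.D n 0 x) := by
      rw [h1, neg_neg]
    rw [h2, map_neg, C.T_D_succ (n + 1) i (by omega), C.T_D_zero]
    rfl
  -- Here both cofaces are last ones, and both sides reduce to `-T² D₀ D₀ x`.
  · have h1 := C.D_D n 0 1 (by omega) (by omega) x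
    have h2 := C.T_D_succ (n + 1) (n + 1) le_rfl (C.D n 0 x)
    rw [← C.T_D_zero n, ← C.T_D_succ (n + 1) 0 (by omega), h1]
    simp only [Nat.sub_self, map_neg]
    rw [show n + 2 - 1 = n + 1 by omega, ← C.T_D_zero n, ← h2, ← C.T_D_zero (n + 1)]

/-- Passing from `M` to `M + 1` adds the row `j = M + 1` and the column `i = M`, which cancel
termwise since `D_{M+1} D_i = -D_i D_M`. The cases `M = n + 2` and `M = n + 1` yield `b b = 0` and
`b' b' = 0`. -/
theorem sum_D_D (n M : ℕ) (hM : M ≤ n + 2) (x : V n) :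
    ∑ j ∈ Finset.range (M + 1), ∑ i ∈ Finset.range M, C.D (n + 1) j (C.D n i x) = 0 := by
  induction M with
  | zero => simp
  | succ M ih =>
    rw [Finset.sum_range_succ, Finset.sum_congr rfl fun j _ => Finset.sum_range_succ _ M,
      Finset.sum_add_distrib, ih (by omega), zero_add, ← Finset.sum_add_distrib]
    refine Finset.sum_eq_zero fun i hi => ?_
    rw [C.D_D' n i (M + 1) (by simpa using hi) (by omega), Nat.add_sub_cancel, add_neg_cancel]

theorem b_b (n : ℕ) (x : V n) : C.b (n + 1) (C.b n x) = 0 := by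
  simp only [b_apply, map_sum]
  rw [Finset.sum_comm]
  exact C.sum_D_D n (n + 2) le_rfl x

theorem b'_b' (n : ℕ) (x : V n) : C.b' (n + 1) (C.b' n x) = 0 := by
  simp only [b'_apply, map_sum]
  rw [Finset.sum_comm]
  exact C.sum_D_D n (n + 1) (by omega) x

/-- `T b = b' T + D_{n+1}`. -/
theorem T_b (n : ℕ) (x : V n) :
    C.T (n + 1) (C.b n x) = C.b' n (C.T n x) + C.D n (n + 1) x := by
  rw [b_apply, b'_apply, map_sum, Finset.sum_range_succ', C.T_D_zero]
  congr 1
  exact Finset.sum_congr rfl fun i hi => C.T_D_succ n i (by simpa [Nat.lt_succ_iff] using hi) x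

/-- `b' (1 - T) = (1 - T) b`. -/
theorem b'_sub (n : ℕ) (x : V n) :
    C.b' n (x - C.T n x) = C.b n x - C.T (n + 1) (C.b n x) := by
  rw [T_b, b_eq, map_sub]
  abel

theorem N_T (n : ℕ) (x : V n) : C.N n (C.T n x) = C.N n x := by
  have h : ∀ k, (C.T n ^ k) (C.T n x) = (C.T n ^ (k + 1)) x := fun k => by
    rw [pow_succ, Module.End.mul_apply]
  rw [N_apply, N_apply, Finset.sum_congr rfl fun k _ => h k, Finset.sum_range_succ,
    Finset.sum_range_succ' _ n, C.T_pow, pow_zero]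

theorem T_N (n : ℕ) (x : V n) : C.T n (C.N n x) = C.N n x := by
  conv_rhs => rw [← C.N_T n x]
  rw [N_apply, N_apply, map_sum]
  refine Finset.sum_congr rfl fun k _ => ?_
  rw [← Module.End.mul_apply, ← Module.End.mul_apply, ← pow_succ, ← pow_succ']

theorem N_D (n i : ℕ) (hi : i ≤ n + 1) (x : V n) :
    C.N (n + 1) (C.D n i x) = C.N (n + 1) (C.D n 0 ((C.T n ^ i) x)) := by
  induction i generalizing x with
  | zero => simp
  | succ i ih =>
    rw [← C.N_T, C.T_D_succ n i (by omega), ih (by omega), pow_succ]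
    rfl

theorem N_b' (n : ℕ) (x : V n) : C.N (n + 1) (C.b' n x) = C.N (n + 1) (C.D n 0 (C.N n x)) := by
  rw [b'_apply, N_apply C n, map_sum, map_sum, map_sum]
  refine Finset.sum_congr rfl fun i hi => C.N_D n i ?_ x
  have := Finset.mem_range.1 hi
  omega

theorem T_pow_D_zero (n k : ℕ) (hk : k ≤ n + 1) (x : V n) :
    (C.T (n + 1) ^ (k + 1)) (C.D n 0 x) = C.D n (n + 1 - k) ((C.T n ^ k) x) := by
  induction k with
  | zero => simp [C.T_D_zero]
  | succ k ih =>
    rw [pow_succ', Module.End.mul_apply, ih (by omega),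
      show n + 1 - k = n + 1 - (k + 1) + 1 by omega, C.T_D_succ n _ (by omega), pow_succ' (C.T n)]
    rfl

theorem T_pow_N (n k : ℕ) (x : V n) : (C.T n ^ k) (C.N n x) = C.N n x := by
  induction k with
  | zero => simp
  | succ k ih => rw [pow_succ, Module.End.mul_apply, C.T_N, ih]

/-- `b N = N b'`. -/
theorem b_N (n : ℕ) (x : V n) : C.b n (C.N n x) = C.N (n + 1) (C.b' n x) := by
  -- The extra `T` turns `N D₀ N` into the sum of the `T^{k+1} D₀ N = D_{n+1-k} T^k N = D_{n+1-k}
  -- N`, which is `b N` summed in reverse order.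
  rw [N_b', ← C.N_T (n + 1), N_apply C (n + 1), b_apply, ← Finset.sum_range_reflect]
  refine Finset.sum_congr rfl fun k hk => ?_
  have := Finset.mem_range.1 hk
  rw [← Module.End.mul_apply (C.T (n + 1) ^ k), ← pow_succ, C.T_pow_D_zero n k (by omega),
    C.T_pow_N]
  rfl

/-- Summing `(1 - T)(1 + ⋯ + T^{k-1}) = 1 - T^k` over `k ≤ n` gives `(n + 1) - N`, so on `ker N`
dividing by `n + 1` inverts `1 - T`. -/
theorem exists_sub_T_of_N_eq_zero (n : ℕ) (x : V n) (hx : C.N n x = 0) :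
    ∃ q, q - C.T n q = x := by
  refine ⟨((n : ℂ) + 1)⁻¹ • ∑ k ∈ Finset.range (n + 1),
    (∑ l ∈ Finset.range k, C.T n ^ l) x, ?_⟩
  have h : ∀ k, (∑ l ∈ Finset.range k, C.T n ^ l) x - C.T n ((∑ l ∈ Finset.range k, C.T n ^ l) x)
      = x - (C.T n ^ k) x := fun k => by
    have := congrArg (fun L : Module.End ℂ (V n) => L x) (mul_neg_geom_sum (C.T n) k)
    simpa [sub_mul] using this
  have hn : (n : ℂ) + 1 ≠ 0 := by exact_mod_cast n.succ_ne_zero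
  rw [map_smul, ← smul_sub, map_sum, ← Finset.sum_sub_distrib, Finset.sum_congr rfl fun k _ => h k,
    Finset.sum_sub_distrib, ← N_apply, hx, sub_zero, Finset.sum_const, Finset.card_range,
    ← Nat.cast_smul_eq_nsmul ℂ, smul_smul]
  push_cast
  rw [inv_mul_cancel₀ hn, one_smul]

theorem N_of_T_eq (n : ℕ) (x : V n) (hx : C.T n x = x) : C.N n x = ((n : ℂ) + 1) • x := by
  have h : ∀ k, (C.T n ^ k) x = x := fun k => by
    induction k with
    | zero => simp
    | succ k ih => rw [pow_succ, Module.End.mul_apply, hx, ih]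
  rw [N_apply, Finset.sum_congr rfl fun k _ => h k, Finset.sum_const, Finset.card_range,
    ← Nat.cast_smul_eq_nsmul ℂ]
  push_cast
  rfl

/-- Write `(1 - T) g = b' h`. Then `b N h = N (1 - T) g = 0`, so `N h` is a cyclic cocycle of lower
degree, and by `ih` it is zero or `b k` with `k` cyclic. Changing `h` by a multiple of `b' k` leaves
`b' h` unchanged and makes `N h` vanish, so `h` becomes `(1 - T) q`. -/
theorem exists_b'_sub_T_eq
    (hb' : ∀ n x, C.b' (n + 1) x = 0 → ∃ y, C.b' n y = x)
    (n : ℕ) (g : V (n + 1)) (hg : C.b' (n + 1) (g - C.T (n + 1) g) = 0)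
    (ih : ∀ x : V n, C.T n x = x → C.b n x = 0 →
      (n = 0 → x = 0) ∧ ∀ m (e : n = m + 1), ∃ y, C.T m y = y ∧ C.b m y = e ▸ x) :
    ∃ q, C.b' n (q - C.T n q) = g - C.T (n + 1) g := by
  obtain ⟨h, hh⟩ := hb' n _ hg
  have hN : C.b n (C.N n h) = 0 := by
    rw [b_N, hh, map_sub, N_T, sub_self]
  obtain ⟨h0, h1⟩ := ih _ (C.T_N n h) hN
  cases n with
  | zero =>
    obtain ⟨q, hq⟩ := C.exists_sub_T_of_N_eq_zero 0 h (h0 rfl)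
    exact ⟨q, by rw [hq, hh]⟩
  | succ m =>
    obtain ⟨k, hk, hk'⟩ := h1 m rfl
    have hm : (m : ℂ) + 1 ≠ 0 := by exact_mod_cast m.succ_ne_zero
    -- The factor compensates `N b' k = b N k = (m + 1) b k`, as `N` is multiplication by `m + 1` on
    -- cyclic elements.
    have hz : C.N (m + 1) (h - ((m : ℂ) + 1)⁻¹ • C.b' m k) = 0 := by
      rw [map_sub, map_smul, ← b_N, C.N_of_T_eq m k hk, map_smul, smul_smul, inv_mul_cancel₀ hm,
        one_smul, hk', sub_self]
    obtain ⟨q, hq⟩ := C.exists_sub_T_of_N_eq_zero _ _ hz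
    exact ⟨q, by rw [hq, map_sub, map_smul, b'_b', smul_zero, sub_zero, hh]⟩

/-- If the Hochschild complex and the bar complex are acyclic, then so is the cyclic complex. -/
theorem cyclic_acyclic (hb0 : ∀ x, C.b 0 x = 0 → x = 0)
    (hb : ∀ n x, C.b (n + 1) x = 0 → ∃ y, C.b n y = x)
    (hb'0 : ∀ x, C.b' 0 x = 0 → x = 0)
    (hb' : ∀ n x, C.b' (n + 1) x = 0 → ∃ y, C.b' n y = x) (n : ℕ) (x : V (n + 1))
    (hT : C.T (n + 1) x = x) (hx : C.b (n + 1) x = 0) : ∃ y, C.T n y = y ∧ C.b n y = x := by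
  induction n using Nat.strong_induction_on with
  | _ n ih =>
  -- The Hochschild primitive `g` need not be cyclic. Its defect `(1 - T) g` is a `b'`-cocycle, and
  -- it is to be removed by subtracting a coboundary `b q`, which leaves `b g` unchanged.
  obtain ⟨g, hg⟩ := hb n x hx
  have hg' : C.b' n (g - C.T n g) = 0 := by rw [b'_sub, hg, hT, sub_self]
  cases n with
  | zero => exact ⟨g, (sub_eq_zero.1 (hb'0 _ hg')).symm, hg⟩
  | succ n =>
    obtain ⟨q, hq⟩ := C.exists_b'_sub_T_eq hb' n g hg' fun y hy hy' => by
      refine ⟨fun e => by subst e; exact hb0 y hy', fun m e => ?_⟩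
      subst e
      exact ih m (by omega) y hy hy'
    refine ⟨g - C.b n q, ?_, by rw [map_sub, b_b, sub_zero, hg]⟩
    rw [b'_sub] at hq
    rw [map_sub, eq_comm, ← sub_eq_zero, sub_sub_sub_comm, hq, sub_self]

end CocyclicModule

/-! ### The homotopy between the identity and `π₀ ⋯ πₙ`. -/

/-- Operators on a cochain complex with signed cofaces `D` that give a contracting homotopy of
`1 - π₀ ⋯ πₙ`: signed codegeneracy-like maps `S` and maps `π`. -/
structure SplittingOperators {V : ℕ → Type*} [∀ n, AddCommGroup (V n)] [∀ n, Module ℂ (V n)]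
    (D : ∀ n, ℕ → V n →ₗ[ℂ] V (n + 1)) where
  /-- The signed codegeneracies. -/
  S : ∀ n, ℕ → V (n + 1) →ₗ[ℂ] V n
  /-- The splitting operators. -/
  π : ∀ n, ℕ → V n →ₗ[ℂ] V n
  S_D_lt : ∀ n k i, k ≤ i → i ≤ n → ∀ x : V (n + 1),
    S (n + 1) (i + 1) (D (n + 1) k x) = -D n k (S n i x)
  S_D_self : ∀ n i, i ≤ n → ∀ x : V n, S n i (D n i x) = x
  S_D_succ : ∀ n i, i ≤ n → ∀ x : V n, S n i (D n (i + 1) x) = -π n i x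
  S_D_gt : ∀ n i k, i < k → k ≤ n + 1 → ∀ x : V (n + 1),
    S (n + 1) i (D (n + 1) (k + 1) x) = -D n k (S n i x)
  π_D_lt : ∀ n k l, k ≤ l → l < n → ∀ x : V n, π (n + 1) (l + 1) (D n k x) = D n k (π n l x)
  π_D_self : ∀ n k, k ≤ n → ∀ x : V n, π (n + 1) k (D n k x) = D n k x
  π_D_gt : ∀ n k l, l < k → l < n → k ≤ n + 1 → ∀ x : V n,
    π (n + 1) l (D n k x) = D n k (π n l x)

namespace SplittingOperators

variable {V : ℕ → Type*} [∀ n, AddCommGroup (V n)] [∀ n, Module ℂ (V n)]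
  {D : ∀ n, ℕ → V n →ₗ[ℂ] V (n + 1)} (P : SplittingOperators D)

/-- The product `π₀ ⋯ πᵢ₋₁`. -/
def prodπ (n : ℕ) : ℕ → V n →ₗ[ℂ] V n
  | 0 => LinearMap.id
  | i + 1 => prodπ n i ∘ₗ P.π n i

theorem prodπ_succ (n i : ℕ) (x : V n) : P.prodπ n (i + 1) x = P.prodπ n i (P.π n i x) := rfl

theorem prodπ_D_gt (n i k : ℕ) (hi : i ≤ k) (hk : k ≤ n + 1) (hn : i ≤ n) (x : V n) :
    P.prodπ (n + 1) i (D n k x) = D n k (P.prodπ n i x) := by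
  induction i generalizing x with
  | zero => rfl
  | succ i ih =>
    rw [prodπ_succ, P.π_D_gt n k i (by omega) (by omega) hk, ih (by omega) (by omega)]
    rfl

/-- The factor `π_k` is absorbed by `D_k`. The factors with larger index drop by one when they pass
`D_k`, and the others commute with it. -/
theorem prodπ_D_lt (n i k : ℕ) (hk : k ≤ i) (hn : i ≤ n) (x : V n) :
    P.prodπ (n + 1) (i + 1) (D n k x) = D n k (P.prodπ n i x) := by
  induction i generalizing x with
  | zero =>
    obtain rfl : k = 0 := by omega
    rw [prodπ_succ, P.π_D_self n 0 (by omega)]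
    rfl
  | succ i ih =>
    rcases hk.lt_or_eq with h | rfl
    · rw [prodπ_succ, P.π_D_lt n k i (by omega) (by omega), ih (by omega) (by omega)]
      rfl
    · rw [prodπ_succ, P.π_D_self n _ hn, P.prodπ_D_gt n _ _ le_rfl (by omega) hn]

/-- The `i`-th summand of the contracting homotopy. -/
def H (n i : ℕ) : V (n + 1) →ₗ[ℂ] V n := P.prodπ n i ∘ₗ P.S n i

/-- The contracting homotopy. -/
def homotopy (n : ℕ) : V (n + 1) →ₗ[ℂ] V n := ∑ i ∈ Finset.range (n + 1), P.H n i

theorem H_D_lt (n k i : ℕ) (hk : k ≤ i) (hi : i ≤ n) (x : V (n + 1)) :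
    P.H (n + 1) (i + 1) (D (n + 1) k x) = -D n k (P.H n i x) := by
  simp only [H, LinearMap.comp_apply]
  rw [P.S_D_lt n k i hk hi, map_neg, P.prodπ_D_lt n i k hk hi]

theorem H_D_gt (n i k : ℕ) (hk : i < k) (hkn : k ≤ n + 1) (x : V (n + 1)) :
    P.H (n + 1) i (D (n + 1) (k + 1) x) = -D n k (P.H n i x) := by
  simp only [H, LinearMap.comp_apply]
  rw [P.S_D_gt n i k hk hkn, map_neg, P.prodπ_D_gt n i k hk.le hkn (by omega)]

theorem H_D_self (n i : ℕ) (hi : i ≤ n) (x : V n) : P.H n i (D n i x) = P.prodπ n i x := by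
  simp only [H, LinearMap.comp_apply]
  rw [P.S_D_self n i hi]

theorem H_D_succ (n i : ℕ) (hi : i ≤ n) (x : V n) :
    P.H n i (D n (i + 1) x) = -P.prodπ n (i + 1) x := by
  simp only [H, LinearMap.comp_apply]
  rw [P.S_D_succ n i hi, map_neg]
  rfl

theorem homotopy_apply (n : ℕ) (x : V (n + 1)) :
    P.homotopy n x = ∑ i ∈ Finset.range (n + 1), P.H n i x := by
  simp [homotopy]

theorem homotopy_zero (x : V 0) :
    P.homotopy 0 (∑ k ∈ Finset.range 2, D 0 k x) = x - P.prodπ 0 1 x := by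
  rw [homotopy_apply, Finset.sum_range_succ, Finset.range_zero, Finset.sum_empty, zero_add, map_sum,
    Finset.sum_range_succ,
    Finset.sum_range_one, P.H_D_self 0 0 le_rfl, P.H_D_succ 0 0 le_rfl, sub_eq_add_neg]
  rfl

/-- The terms `k = i` and `k = i + 1` give the difference of consecutive partial products, which
telescopes over `i`; all other terms move the coface outside. For `i = 0` the truncated index `i -
1` occurs only in an empty sum. -/
theorem sum_H_D (n i : ℕ) (hi : i ≤ n + 1) (x : V (n + 1)) :
    ∑ k ∈ Finset.range (n + 3), P.H (n + 1) i (D (n + 1) k x) =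
      P.prodπ (n + 1) i x - P.prodπ (n + 1) (i + 1) x -
        ∑ k ∈ Finset.range i, D n k (P.H n (i - 1) x) -
        ∑ k ∈ Finset.Ico (i + 1) (n + 2), D n k (P.H n i x) := by
  rw [Finset.range_eq_Ico, ← Finset.sum_Ico_consecutive _ (Nat.zero_le i) (by omega),
    ← Finset.sum_Ico_consecutive _ (Nat.le_add_right i 2) (by omega),
    Finset.sum_Ico_succ_top (by omega : i ≤ i + 1), Nat.Ico_succ_singleton, Finset.sum_singleton,
    P.H_D_self _ _ hi, P.H_D_succ _ _ hi,
    show n + 3 = n + 2 + 1 by rfl, show i + 2 = i + 1 + 1 by rfl,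
    ← Finset.sum_Ico_add' (fun k => P.H (n + 1) i (D (n + 1) k x)) (i + 1) (n + 2) 1,
    Finset.sum_congr rfl fun k hk => P.H_D_gt n i k
      (Nat.lt_of_succ_le (Finset.mem_Ico.1 hk).1) (Nat.le_of_lt_succ (Finset.mem_Ico.1 hk).2) x]
  have h : ∑ k ∈ Finset.Ico 0 i, P.H (n + 1) i (D (n + 1) k x) =
      ∑ k ∈ Finset.Ico 0 i, -D n k (P.H n (i - 1) x) := by
    refine Finset.sum_congr rfl fun k hk => ?_
    have := (Finset.mem_Ico.1 hk).2
    obtain ⟨i, rfl⟩ : ∃ m, i = m + 1 := ⟨i - 1, by omega⟩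
    exact P.H_D_lt n k i (by omega) (by omega) x
  rw [h, Finset.sum_neg_distrib, Finset.sum_neg_distrib, Finset.range_eq_Ico]
  simp only [Nat.succ_eq_add_one]
  abel

/-- After summing `sum_H_D` over `i`, the outer cofaces in front of `H n i` have indices `k ≤ i`
(from the summand `i + 1`) and `k > i` (from the summand `i`), so together they give every coface
once. -/
theorem homotopy_succ (n : ℕ) (x : V (n + 1)) :
    P.homotopy (n + 1) (∑ k ∈ Finset.range (n + 3), D (n + 1) k x) =
      x - P.prodπ (n + 1) (n + 2) x - ∑ k ∈ Finset.range (n + 2), D n k (P.homotopy n x) := by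
  rw [homotopy_apply, homotopy_apply]
  simp only [map_sum]
  rw [Finset.sum_congr rfl fun i hi => P.sum_H_D n i (Finset.mem_range_succ_iff.1 hi) x,
    Finset.sum_sub_distrib, Finset.sum_sub_distrib, Finset.sum_range_sub',
    Finset.sum_range_succ' (fun i => ∑ k ∈ Finset.range i, D n k (P.H n (i - 1) x)),
    Finset.sum_range_succ (fun i => ∑ k ∈ Finset.Ico (i + 1) (n + 2), D n k (P.H n i x)),
    Finset.Ico_self, Finset.sum_empty, Finset.range_zero, Finset.sum_empty, add_zero, add_zero,
    sub_sub, ← Finset.sum_add_distrib, Finset.sum_comm (s := Finset.range (n + 2))]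
  congr 1
  refine Finset.sum_congr rfl fun i hi => ?_
  exact Finset.sum_range_add_sum_Ico _ (by have := Finset.mem_range.1 hi; omega)

end SplittingOperators

/-! ### Cochains of an algebra as a cocyclic space, computed on sequences indexed by `ℕ`. -/

section Evaluation

theorem restrict_update {α : Type*} {n : ℕ} (a : ℕ → α) (i : ℕ) (hi : i < n + 1) (c : α) :
    (fun k : Fin (n + 1) => Function.update a i c k) =
      Function.update (fun k : Fin (n + 1) => a k) ⟨i, hi⟩ c := by
  funext k
  simp [Function.update_apply, Fin.ext_iff]

variable {A : Type*} [NormedRing A] [NormedAlgebra ℂ A]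

/-- The value of an `n`-cochain at the first `n + 1` terms of a sequence. -/
def ev {n : ℕ} (f : Cochain A n) (a : ℕ → A) : ℂ := f fun k => a k

theorem ev_ext {n : ℕ} {f g : Cochain A n} (h : ∀ a, ev f a = ev g a) : f = g := by
  ext a
  have h' := h fun k => if hk : k < n + 1 then a ⟨k, hk⟩ else 0
  simpa only [ev, Fin.is_lt, dite_true, Fin.eta] using h'

theorem ev_congr {n : ℕ} (f : Cochain A n) {a a' : ℕ → A} (h : ∀ k ≤ n, a k = a' k) :
    ev f a = ev f a' :=
  congrArg f (funext fun k => h k (Nat.le_of_lt_succ k.2))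

theorem ev_sub {n : ℕ} (f g : Cochain A n) (a : ℕ → A) : ev (f - g) a = ev f a - ev g a := rfl

theorem ev_neg {n : ℕ} (f : Cochain A n) (a : ℕ → A) : ev (-f) a = -ev f a := rfl

theorem ev_zero {n : ℕ} (a : ℕ → A) : ev (0 : Cochain A n) a = 0 := rfl

theorem ev_sum {n : ℕ} {ι : Type*} (s : Finset ι) (f : ι → Cochain A n) (a : ℕ → A) :
    ev (∑ j ∈ s, f j) a = ∑ j ∈ s, ev (f j) a := by
  simp [ev]

theorem ev_update_sum {n : ℕ} {ι : Type*} (s : Finset ι) (f : Cochain A n) (a : ℕ → A) (i : ℕ)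
    (hi : i ≤ n) (c : ι → A) :
    ∑ j ∈ s, ev f (Function.update a i (c j)) = ev f (Function.update a i (∑ j ∈ s, c j)) := by
  simp only [ev, restrict_update a i (Nat.lt_succ_of_le hi)]
  exact (f.toMultilinearMap.map_update_sum s _ _ _).symm

theorem ev_eq_zero {n : ℕ} (f : Cochain A n) (a : ℕ → A) (i : ℕ) (hi : i ≤ n) (h : a i = 0) :
    ev f a = 0 :=
  f.map_coord_zero ⟨i, Nat.lt_succ_of_le hi⟩ h

/-- The sequence obtained from `a` by multiplying the `i`-th and the `(i+1)`-st terms, or the last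
and the first terms if `i > n`. -/
def contract (n i : ℕ) (a : ℕ → A) (k : ℕ) : A :=
  if i ≤ n then if k < i then a k else if k = i then a i * a (i + 1) else a (k + 1)
  else if k = 0 then a (n + 1) * a 0 else a k

/-- The sequence `aₙ, a₀, …, aₙ₋₁, …`. -/
def rotate (n : ℕ) (a : ℕ → A) (k : ℕ) : A := if k = 0 then a n else a (k - 1)

variable (A)

/-- The signed coface maps of the cochains of a Banach algebra. -/
def coface (n i : ℕ) : Cochain A n →ₗ[ℂ] Cochain A (n + 1) where
  toFun f := (-1 : ℂ) ^ i • if h : i < n + 1 then face ⟨i, h⟩ f else lastFace f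
  map_add' f g := by
    split_ifs
    · exact smul_add _ (face _ f) (face _ g)
    · exact smul_add _ (lastFace f) (lastFace g)
  map_smul' c f := by
    split_ifs
    · exact smul_comm _ c (face _ f)
    · exact smul_comm _ c (lastFace f)

/-- The signed cyclic operators on the cochains of a Banach algebra. -/
def cyclicOperator (n : ℕ) : Cochain A n →ₗ[ℂ] Cochain A n where
  toFun f := (-1 : ℂ) ^ n • f.domDomCongr (finRotate (n + 1)).symm
  map_add' f g := smul_add _ (f.domDomCongr _) (g.domDomCongr _)
  map_smul' c f := smul_comm _ c (f.domDomCongr _)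

variable {A}

theorem ev_coface (n i : ℕ) (f : Cochain A n) (a : ℕ → A) :
    ev (coface A n i f) a = (-1) ^ i * ev f (contract n i a) := by
  change (-1 : ℂ) ^ i * ev (if h : i < n + 1 then face ⟨i, h⟩ f else lastFace f) a = _
  congr 1
  split_ifs with h
  · rw [ev, face_apply]
    refine congrArg f (funext fun k => ?_)
    simp only [Fin.contractNth, contract, Fin.val_castSucc, Fin.val_succ,
      if_pos (Nat.le_of_lt_succ h)]
    split_ifs <;> simp_all
  · rw [ev, lastFace_apply]
    refine congrArg f (funext fun k => ?_)
    refine Fin.cases ?_ (fun k => ?_) k <;>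
    simp [contract, show ¬ i ≤ n by omega]

theorem finRotate_symm_val (n : ℕ) (k : Fin (n + 1)) :
    ((finRotate (n + 1)).symm k : ℕ) = if (k : ℕ) = 0 then n else (k : ℕ) - 1 := by
  obtain ⟨m, rfl⟩ := (finRotate (n + 1)).surjective k
  rw [Equiv.symm_apply_apply]
  rcases eq_or_ne m (Fin.last n) with rfl | h
  · simp
  · rw [coe_finRotate_of_ne_last h]
    simp

theorem ev_cyclicOperator (n : ℕ) (f : Cochain A n) (a : ℕ → A) :
    ev (cyclicOperator A n f) a = (-1) ^ n * ev f (rotate n a) := by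
  change (-1 : ℂ) ^ n * f (fun k => a ((finRotate (n + 1)).symm k)) = _
  congr 1
  refine congrArg f (funext fun k => ?_)
  rw [finRotate_symm_val, rotate]
  split_ifs <;> rfl

theorem coface_coface (n i j : ℕ) (hij : i < j) (hj : j ≤ n + 1) (f : Cochain A n) :
    coface A (n + 1) j (coface A n i f) = -coface A (n + 1) i (coface A n (j - 1) f) := by
  obtain ⟨m, rfl⟩ : ∃ m, j = m + 1 := ⟨j - 1, by omega⟩
  refine ev_ext fun a => ?_
  rw [ev_neg, ev_coface, ev_coface, ev_coface,
    ev_coface, ev_congr f (a' := contract n (m + 1 - 1) (contract (n + 1) i a))]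
  · rw [Nat.add_sub_cancel]
    ring
  · intro k hk
    simp only [contract]
    grind

theorem cyclicOperator_coface_succ (n i : ℕ) (hi : i ≤ n) (f : Cochain A n) :
    cyclicOperator A (n + 1) (coface A n (i + 1) f) = coface A n i (cyclicOperator A n f) := by
  refine ev_ext fun a => ?_
  rw [ev_cyclicOperator, ev_coface, ev_coface, ev_cyclicOperator,
    ev_congr f (a' := rotate n (contract n i a))]
  · ring
  · intro k hk
    simp only [contract, rotate]
    grind

theorem cyclicOperator_coface_zero (n : ℕ) (f : Cochain A n) :
    cyclicOperator A (n + 1) (coface A n 0 f) = coface A n (n + 1) f := by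
  refine ev_ext fun a => ?_
  rw [ev_cyclicOperator, ev_coface, ev_coface,
    ev_congr f (a' := contract n (n + 1) a)]
  · ring
  · intro k hk
    simp only [contract, rotate]
    grind

theorem ev_cyclicOperator_pow (n i : ℕ) (hi : i ≤ n + 1) (f : Cochain A n) (a : ℕ → A) :
    ev ((cyclicOperator A n ^ i) f) a =
      ((-1) ^ n) ^ i * ev f fun k => if k < i then a (n + 1 + k - i) else a (k - i) := by
  induction i generalizing f a with
  | zero => simp
  | succ i ih =>
    rw [pow_succ, Module.End.mul_apply, ih (by omega), ev_cyclicOperator, pow_succ, mul_assoc]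
    congr 2
    refine ev_congr f fun k hk => ?_
    simp only [rotate]
    grind

theorem cyclicOperator_pow (n : ℕ) : cyclicOperator A n ^ (n + 1) = 1 := by
  refine LinearMap.ext fun f => ev_ext fun a => ?_
  -- The full rotation has sign `(-1)^{n(n+1)} = 1`.
  rw [ev_cyclicOperator_pow n _ le_rfl, ← pow_mul, (Nat.even_mul_succ_self n).neg_one_pow, one_mul,
    Module.End.one_apply]
  refine ev_congr f fun k hk => ?_
  rw [if_pos (by omega), Nat.add_sub_cancel_left]

variable (A)

/-- The cocyclic space of cochains of a Banach algebra. -/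
def cochainModule : CocyclicModule (Cochain A) where
  D := coface A
  T := cyclicOperator A
  D_D := coface_coface
  T_D_succ := cyclicOperator_coface_succ
  T_D_zero := cyclicOperator_coface_zero
  T_pow := cyclicOperator_pow

variable {A}

theorem cochainModule_b (n : ℕ) : (cochainModule A).b n = coboundary n := by
  refine LinearMap.ext fun f => ?_
  rw [CocyclicModule.b_apply, Finset.sum_range_succ, Finset.sum_range]
  simp only [cochainModule, coface, coboundary, LinearMap.coe_mk, AddHom.coe_mk, Fin.is_lt,
    dif_pos, lt_self_iff_false, dif_neg, not_false_eq_true]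

theorem mem_cyclicCochains_iff (n : ℕ) (f : Cochain A n) :
    f ∈ cyclicCochains A n ↔ cyclicOperator A n f = f := by
  have h1 : ((-1 : ℂ) ^ n) * (-1) ^ n = 1 := by rw [← mul_pow]; simp
  have h2 : ∀ k : Fin (n + 1), k + 1 = finRotate (n + 1) k := fun k => by simp
  constructor
  · intro h
    ext a
    change (-1 : ℂ) ^ n * f (fun k => a ((finRotate (n + 1)).symm k)) = _
    rw [← h fun k => a ((finRotate (n + 1)).symm k), ← mul_assoc, h1, one_mul]
    refine congrArg f (funext fun k => ?_)
    rw [h2, Equiv.symm_apply_apply]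
  · intro h a
    conv_lhs => rw [← h]
    change (-1 : ℂ) ^ n * ((-1 : ℂ) ^ n * f (fun k => a ((finRotate (n + 1)).symm k + 1))) = _
    rw [← mul_assoc, h1, one_mul]
    refine congrArg f (funext fun k => ?_)
    rw [h2, Equiv.apply_symm_apply]

/-- The contraction `f ↦ f (1, a₀, …)` of the bar complex. -/
theorem exists_b'_eq (n : ℕ) (f : Cochain A (n + 1)) (hf : (cochainModule A).b' (n + 1) f = 0) :
    ∃ g, (cochainModule A).b' n g = f := by
  have key : ∀ (m : ℕ) (g : Cochain A (m + 1)) (a : ℕ → A),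
      ev (g.curryLeft 1) a = ev g fun k => if k = 0 then 1 else a (k - 1) := fun m g a => by
    refine congrArg g (funext fun k => ?_)
    refine Fin.cases ?_ (fun k => ?_) k <;> simp
  refine ⟨f.curryLeft 1, ev_ext fun a => ?_⟩
  -- At `(1, a₀, a₁, …)` the coface of index `0` returns `f a`, and the one of index `i + 1` is
  -- minus the `i`-th coface of `f (1, ·)`.
  have h := congrArg (fun g => ev g fun k => if k = 0 then 1 else a (k - 1)) hf
  simp only [CocyclicModule.b'_apply, ev_sum, ev_zero] at h ⊢
  rw [Finset.sum_range_succ'] at h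
  have h0 : ev ((cochainModule A).D (n + 1) 0 f) (fun k => if k = 0 then 1 else a (k - 1)) =
      ev f a := by
    refine (ev_coface _ _ _ _).trans ?_
    rw [pow_zero, one_mul]
    refine ev_congr f fun k hk => ?_
    simp only [contract]
    grind
  rw [h0] at h
  rw [← sub_eq_zero, ← neg_eq_zero, ← h, neg_sub, sub_eq_add_neg, add_comm, ← Finset.sum_neg_distrib]
  congr 1
  refine Finset.sum_congr rfl fun i hi => ?_
  have := Finset.mem_range.1 hi
  refine (congrArg _ (ev_coface _ _ _ _)).trans
    (Eq.trans ?_ (ev_coface _ _ _ _).symm)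
  rw [key, ev_congr f (a' := contract (n + 1) (i + 1) fun k => if k = 0 then 1 else a (k - 1))]
  · ring
  · intro k hk
    simp only [contract]
    grind

theorem eq_zero_of_b' (f : Cochain A 0) (hf : (cochainModule A).b' 0 f = 0) : f = 0 := by
  refine ev_ext fun a => ?_
  have h := congrArg (fun g => ev g fun k => if k = 0 then 1 else a (k - 1)) hf
  simp only [CocyclicModule.b'_apply, ev_zero, Finset.sum_range_succ, Finset.range_zero,
    Finset.sum_empty, zero_add] at h
  rw [ev_zero, ← h]
  refine Eq.trans ?_ (ev_coface _ _ _ _).symm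
  rw [pow_zero, one_mul]
  refine ev_congr f fun k hk => ?_
  simp only [contract]
  grind

end Evaluation

/-! ### Inserting `∑ uⱼ ⊗ vⱼ` with `∑ uⱼ vⱼ = 1` into cochains. -/

section Splitting

variable {A : Type*} [NormedRing A] [NormedAlgebra ℂ A]

/-- The sequence `a₀, …, aᵢ u, v, aᵢ₊₁, …`. -/
def insertPair (i : ℕ) (u v : A) (a : ℕ → A) (k : ℕ) : A :=
  if k < i then a k else if k = i then a i * u else if k = i + 1 then v else a (k - 1)

/-- The sequence `a₀, …, aᵢ u, v aᵢ₊₁, …, aₙ`, indices being taken modulo `n + 1`. -/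
def multiplyPair (n i : ℕ) (u v : A) (a : ℕ → A) (k : ℕ) : A :=
  (if k = i + 1 ∨ (i = n ∧ k = 0) then v else 1) * a k * if k = i then u else 1

/-- The operator `f ↦ (-1)ⁱ f (a₀, …, aᵢ u, v, aᵢ₊₁, …, aₙ)`. -/
def insertOperator (n i : ℕ) (u v : A) : Cochain A (n + 1) →ₗ[ℂ] Cochain A n where
  toFun f := (-1 : ℂ) ^ i • (f.curryMid (Fin.ofNat (n + 2) (i + 1)) v).compContinuousLinearMap
    fun k => (ContinuousLinearMap.mul ℂ A).flip (if (k : ℕ) = i then u else 1)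
  map_add' f g := by
    ext a
    simp [mul_add]
  map_smul' c f := by
    ext a
    simp [mul_left_comm]

/-- The operator `f ↦ f (a₀, …, aᵢ u, v aᵢ₊₁, …, aₙ)`, indices being taken modulo `n + 1`. -/
def multiplyOperator (n i : ℕ) (u v : A) : Cochain A n →ₗ[ℂ] Cochain A n where
  toFun f := f.compContinuousLinearMap fun k =>
    (ContinuousLinearMap.mul ℂ A).flip (if (k : ℕ) = i then u else 1) ∘L
      ContinuousLinearMap.mul ℂ A (if (k : ℕ) = i + 1 ∨ (i = n ∧ (k : ℕ) = 0) then v else 1)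
  map_add' _ _ := rfl
  map_smul' _ _ := rfl

theorem ev_insertOperator (n i : ℕ) (hi : i ≤ n) (u v : A) (f : Cochain A (n + 1)) (a : ℕ → A) :
    ev (insertOperator n i u v f) a = (-1) ^ i * ev f (insertPair i u v a) := by
  change (-1 : ℂ) ^ i * f ((Fin.ofNat (n + 2) (i + 1)).insertNth v fun k : Fin (n + 1) =>
    a k * if (k : ℕ) = i then u else 1) = _
  congr 1
  refine congrArg f ?_
  have hv : (Fin.ofNat (n + 2) (i + 1) : ℕ) = i + 1 := by
    simp only [Fin.val_ofNat]
    exact Nat.mod_eq_of_lt (by omega)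
  rw [Fin.insertNth_eq_iff]
  refine ⟨?_, funext fun k => ?_⟩
  · rw [hv]
    simp [insertPair]
  · simp only [Fin.removeNth, Fin.succAbove, Fin.lt_def, hv, Fin.val_castSucc, insertPair]
    split_ifs with h1 h2 h2 <;> grind [Fin.val_castSucc]

variable {ι : Type*} [Fintype ι] (u v : ι → A)

/-- The operator `f ↦ (-1)ⁱ ∑ⱼ f (a₀, …, aᵢ uⱼ, vⱼ, aᵢ₊₁, …, aₙ)`. -/
def insertSum (n i : ℕ) : Cochain A (n + 1) →ₗ[ℂ] Cochain A n :=
  ∑ j, insertOperator n i (u j) (v j)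

/-- The operator `f ↦ ∑ⱼ f (a₀, …, aᵢ uⱼ, vⱼ aᵢ₊₁, …, aₙ)`, indices being taken modulo
`n + 1`. -/
def multiplySum (n i : ℕ) : Cochain A n →ₗ[ℂ] Cochain A n :=
  ∑ j, multiplyOperator n i (u j) (v j)

theorem ev_insertSum (n i : ℕ) (hi : i ≤ n) (f : Cochain A (n + 1)) (a : ℕ → A) :
    ev (insertSum u v n i f) a = (-1) ^ i * ∑ j, ev f (insertPair i (u j) (v j) a) := by
  rw [insertSum, LinearMap.sum_apply, ev_sum, Finset.mul_sum]
  exact Finset.sum_congr rfl fun j _ => ev_insertOperator n i hi _ _ f a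

theorem ev_multiplySum (n i : ℕ) (f : Cochain A n) (a : ℕ → A) :
    ev (multiplySum u v n i f) a = ∑ j, ev f (multiplyPair n i (u j) (v j) a) := by
  rw [multiplySum, LinearMap.sum_apply, ev_sum]
  rfl

variable {u v}

theorem insertSum_coface_self (huv : ∑ j, u j * v j = 1) (n i : ℕ) (hi : i ≤ n)
    (f : Cochain A n) : insertSum u v n i (coface A n i f) = f := by
  refine ev_ext fun a => ?_
  rw [ev_insertSum _ _ _ _ hi]
  have h : ∀ j, ev (coface A n i f) (insertPair i (u j) (v j) a) =
      (-1) ^ i * ev f (Function.update a i (a i * (u j * v j))) := fun j => by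
    rw [ev_coface]
    congr 1
    refine ev_congr f fun k hk => ?_
    simp only [contract, insertPair, Function.update_apply]
    grind
  rw [Finset.sum_congr rfl fun j _ => h j, ← Finset.mul_sum, ev_update_sum _ _ _ _ hi,
    ← Finset.mul_sum, huv, mul_one, Function.update_eq_self, ← mul_assoc, ← mul_pow]
  simp

theorem multiplySum_coface_self (huv : ∑ j, u j * v j = 1) (n i : ℕ) (hi : i ≤ n)
    (f : Cochain A n) : multiplySum u v (n + 1) i (coface A n i f) = coface A n i f := by
  refine ev_ext fun a => ?_
  rw [ev_multiplySum]
  have h : ∀ j, ev (coface A n i f) (multiplyPair (n + 1) i (u j) (v j) a) =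
      (-1) ^ i * ev f (Function.update (contract n i a) i (a i * (u j * v j) * a (i + 1))) :=
    fun j => by
    rw [ev_coface]
    congr 1
    refine ev_congr f fun k hk => ?_
    simp only [contract, multiplyPair, Function.update_apply]
    grind
  rw [Finset.sum_congr rfl fun j _ => h j, ← Finset.mul_sum, ev_update_sum _ _ _ _ hi,
    ← Finset.sum_mul, ← Finset.mul_sum, huv, mul_one, ev_coface]
  congr 1
  refine ev_congr f fun k hk => ?_
  simp only [contract, Function.update_apply]
  grind

theorem insertSum_coface_succ (n i : ℕ) (hi : i ≤ n) (f : Cochain A n) :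
    insertSum u v n i (coface A n (i + 1) f) = -multiplySum u v n i f := by
  refine ev_ext fun a => ?_
  rw [ev_insertSum _ _ _ _ hi, ev_neg, ev_multiplySum, Finset.mul_sum, ← Finset.sum_neg_distrib]
  refine Finset.sum_congr rfl fun j _ => ?_
  rw [ev_coface, ev_congr f (a' := multiplyPair n i (u j) (v j) a), ← mul_assoc,
    pow_succ, ← mul_assoc, ← mul_pow]
  · simp
  · intro k hk
    simp only [contract, insertPair, multiplyPair]
    grind

theorem insertSum_coface_lt (n k i : ℕ) (hk : k ≤ i) (hi : i ≤ n) (f : Cochain A (n + 1)) :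
    insertSum u v (n + 1) (i + 1) (coface A (n + 1) k f) = -coface A n k (insertSum u v n i f) := by
  refine ev_ext fun a => ?_
  rw [ev_insertSum _ _ _ _ (by omega), ev_neg, ev_coface, ev_insertSum _ _ _ _ hi,
    Finset.mul_sum, Finset.mul_sum, Finset.mul_sum, ← Finset.sum_neg_distrib]
  refine Finset.sum_congr rfl fun j _ => ?_
  rw [ev_coface, ev_congr f (a' := insertPair i (u j) (v j) (contract n k a))]
  · ring
  · intro l hl
    simp only [contract, insertPair]
    grind

theorem insertSum_coface_gt (n i k : ℕ) (hk : i < k) (hkn : k ≤ n + 1) (f : Cochain A (n + 1)) :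
    insertSum u v (n + 1) i (coface A (n + 1) (k + 1) f) = -coface A n k (insertSum u v n i f) := by
  refine ev_ext fun a => ?_
  rw [ev_insertSum _ _ _ _ (by omega), ev_neg, ev_coface,
    ev_insertSum _ _ _ _ (by omega),
    Finset.mul_sum, Finset.mul_sum, Finset.mul_sum, ← Finset.sum_neg_distrib]
  refine Finset.sum_congr rfl fun j _ => ?_
  rw [ev_coface, ev_congr f (a' := insertPair i (u j) (v j) (contract n k a))]
  · ring
  · intro l hl
    simp only [contract, insertPair]
    grind

/-- The bound `l < n` excludes the operator that wraps around to `a₀`. The same holds in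
`multiplySum_coface_gt`, where the last coface is allowed. -/
theorem multiplySum_coface_lt (n k l : ℕ) (hk : k ≤ l) (hl : l < n) (f : Cochain A n) :
    multiplySum u v (n + 1) (l + 1) (coface A n k f) = coface A n k (multiplySum u v n l f) := by
  refine ev_ext fun a => ?_
  rw [ev_multiplySum, ev_coface, ev_multiplySum, Finset.mul_sum]
  refine Finset.sum_congr rfl fun j _ => ?_
  rw [ev_coface]
  congr 1
  refine ev_congr f fun m hm => ?_
  simp only [contract, multiplyPair]
  grind

theorem multiplySum_coface_gt (n k l : ℕ) (hk : l < k) (hl : l < n) (hkn : k ≤ n + 1)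
    (f : Cochain A n) :
    multiplySum u v (n + 1) l (coface A n k f) = coface A n k (multiplySum u v n l f) := by
  refine ev_ext fun a => ?_
  rw [ev_multiplySum, ev_coface, ev_multiplySum, Finset.mul_sum]
  refine Finset.sum_congr rfl fun j _ => ?_
  rw [ev_coface]
  congr 1
  refine ev_congr f fun m hm => ?_
  simp only [contract, multiplyPair]
  grind

/-- The splitting operators given by `∑ⱼ uⱼ ⊗ vⱼ` with `∑ⱼ uⱼ vⱼ = 1`. -/
def splittingOperators (huv : ∑ j, u j * v j = 1) : SplittingOperators (coface A) where
  S := insertSum u v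
  π := multiplySum u v
  S_D_lt := insertSum_coface_lt
  S_D_self := insertSum_coface_self huv
  S_D_succ := insertSum_coface_succ
  S_D_gt := insertSum_coface_gt
  π_D_lt := multiplySum_coface_lt
  π_D_self := multiplySum_coface_self huv
  π_D_gt := multiplySum_coface_gt

end Splitting

/-! ### Cocyclic subspaces and pullback along multiplicative, possibly non-unital, linear maps. -/

/-- The restriction of a cocyclic vector space to a family of subspaces that is stable under the
cofaces and the cyclic operators. -/
def CocyclicModule.restrict {V : ℕ → Type*} [∀ n, AddCommGroup (V n)] [∀ n, Module ℂ (V n)]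
    (C : CocyclicModule V) (K : ∀ n, Submodule ℂ (V n))
    (hD : ∀ n i, ∀ x ∈ K n, C.D n i x ∈ K (n + 1)) (hT : ∀ n, ∀ x ∈ K n, C.T n x ∈ K n) :
    CocyclicModule fun n => K n where
  D n i := (C.D n i).restrict (hD n i)
  T n := (C.T n).restrict (hT n)
  D_D n i j hij hj x := Subtype.ext (C.D_D n i j hij hj x)
  T_D_succ n i hi x := Subtype.ext (C.T_D_succ n i hi x)
  T_D_zero n x := Subtype.ext (C.T_D_zero n x)
  T_pow n := by
    rw [Module.End.pow_restrict]
    exact LinearMap.ext fun x => Subtype.ext (C.T_pow_apply n x)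

theorem CocyclicModule.coe_restrict_b {V : ℕ → Type*} [∀ n, AddCommGroup (V n)]
    [∀ n, Module ℂ (V n)] (C : CocyclicModule V) (K : ∀ n, Submodule ℂ (V n))
    (hD : ∀ n i, ∀ x ∈ K n, C.D n i x ∈ K (n + 1)) (hT : ∀ n, ∀ x ∈ K n, C.T n x ∈ K n) (n : ℕ)
    (x : K n) : ((C.restrict K hD hT).b n x : V (n + 1)) = C.b n x := by
  rw [b_apply, b_apply, AddSubmonoidClass.coe_finsetSum]
  rfl

theorem CocyclicModule.coe_restrict_b' {V : ℕ → Type*} [∀ n, AddCommGroup (V n)]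
    [∀ n, Module ℂ (V n)] (C : CocyclicModule V) (K : ∀ n, Submodule ℂ (V n))
    (hD : ∀ n i, ∀ x ∈ K n, C.D n i x ∈ K (n + 1)) (hT : ∀ n, ∀ x ∈ K n, C.T n x ∈ K n) (n : ℕ)
    (x : K n) : ((C.restrict K hD hT).b' n x : V (n + 1)) = C.b' n x := by
  rw [b'_apply, b'_apply, AddSubmonoidClass.coe_finsetSum]
  rfl

section LinearPullback

variable {A B : Type*} [NormedRing A] [NormedAlgebra ℂ A] [NormedRing B] [NormedAlgebra ℂ B]

/-- The map `f ↦ f (L a₀, …, L aₙ)` of cochains, for a continuous linear map `L`. -/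
def linearPullback (L : A →L[ℂ] B) (n : ℕ) : Cochain B n →L[ℂ] Cochain A n :=
  ContinuousMultilinearMap.compContinuousLinearMapL fun _ => L

theorem ev_linearPullback (L : A →L[ℂ] B) (n : ℕ) (f : Cochain B n) (a : ℕ → A) :
    ev (linearPullback L n f) a = ev f fun k => L (a k) := rfl

theorem coface_linearPullback (L : A →L[ℂ] B) (hL : ∀ x y, L (x * y) = L x * L y) (n i : ℕ)
    (f : Cochain B n) :
    coface A n i (linearPullback L n f) = linearPullback L (n + 1) (coface B n i f) := by
  refine ev_ext fun a => ?_
  rw [ev_coface, ev_linearPullback, ev_linearPullback, ev_coface]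
  congr 1
  refine ev_congr f fun k hk => ?_
  simp only [contract]
  split_ifs <;> simp [hL]

theorem cyclicOperator_linearPullback (L : A →L[ℂ] B) (n : ℕ) (f : Cochain B n) :
    cyclicOperator A n (linearPullback L n f) = linearPullback L n (cyclicOperator B n f) := rfl

theorem coboundary_linearPullback (L : A →L[ℂ] B) (hL : ∀ x y, L (x * y) = L x * L y) (n : ℕ)
    (f : Cochain B n) :
    coboundary n (linearPullback L n f) = linearPullback L (n + 1) (coboundary n f) := by
  simp only [← cochainModule_b, CocyclicModule.b_apply, map_sum]
  exact Finset.sum_congr rfl fun i _ => coface_linearPullback L hL n i f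

theorem b'_linearPullback (L : A →L[ℂ] B) (hL : ∀ x y, L (x * y) = L x * L y) (n : ℕ)
    (f : Cochain B n) : (cochainModule A).b' n (linearPullback L n f) =
      linearPullback L (n + 1) ((cochainModule B).b' n f) := by
  simp only [CocyclicModule.b'_apply, map_sum]
  exact Finset.sum_congr rfl fun i _ => coface_linearPullback L hL n i f

theorem linearPullback_mem_cyclicCochains (L : A →L[ℂ] B) (n : ℕ) {f : Cochain B n}
    (hf : f ∈ cyclicCochains B n) : linearPullback L n f ∈ cyclicCochains A n :=
  fun a => hf fun k => L (a k)

theorem linearPullback_mem_cyclicCocycles (L : A →L[ℂ] B) (hL : ∀ x y, L (x * y) = L x * L y)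
    (n : ℕ) {f : Cochain B n} (hf : f ∈ cyclicCocycles B n) :
    linearPullback L n f ∈ cyclicCocycles A n := by
  refine ⟨linearPullback_mem_cyclicCochains L n hf.1, ?_⟩
  have h : coboundary n f = 0 := hf.2
  change coboundary n (linearPullback L n f) = 0
  rw [coboundary_linearPullback L hL, h, map_zero]

theorem linearPullback_mem_cyclicCoboundaries (L : A →L[ℂ] B)
    (hL : ∀ x y, L (x * y) = L x * L y) (n : ℕ) {f : Cochain B n}
    (hf : f ∈ cyclicCoboundaries B n) : linearPullback L n f ∈ cyclicCoboundaries A n := by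
  cases n with
  | zero =>
    have h0 : f = 0 := hf
    rw [h0, map_zero]
    exact zero_mem _
  | succ n =>
    obtain ⟨g, hg, rfl⟩ := hf
    exact ⟨linearPullback L n g, linearPullback_mem_cyclicCochains L n hg,
      coboundary_linearPullback L hL n g⟩

end LinearPullback

/-! ### Acyclicity of the cochains that vanish on both corners. -/

section Corners

variable {A : Type*} [NormedRing A] [NormedAlgebra ℂ A]

/-- The compression `x ↦ p x p`. -/
def corner (p : A) : A →L[ℂ] A := ContinuousLinearMap.mulLeftRight ℂ A p p

theorem corner_apply (p x : A) : corner p x = p * x * p := rfl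

/-- The cochains that vanish on the corners `p A p` and `q A q`. -/
def relativeCochains (p q : A) (n : ℕ) : Submodule ℂ (Cochain A n) :=
  LinearMap.ker (linearPullback (corner p) n).toLinearMap ⊓
    LinearMap.ker (linearPullback (corner q) n).toLinearMap

theorem mem_relativeCochains {p q : A} {n : ℕ} {f : Cochain A n} :
    f ∈ relativeCochains p q n ↔
      linearPullback (corner p) n f = 0 ∧ linearPullback (corner q) n f = 0 := Iff.rfl

theorem relativeCochains_swap (p q : A) (n : ℕ) :
    relativeCochains p q n = relativeCochains q p n := inf_comm _ _

theorem ev_eq_zero_of_corner {p q : A} {n : ℕ} {f : Cochain A n} (hf : f ∈ relativeCochains p q n)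
    (a : ℕ → A) (ha : ∀ k ≤ n, p * a k * p = a k) : ev f a = 0 := by
  rw [ev_congr f (a' := fun k => corner p (a k)) fun k hk => (ha k hk).symm, ← ev_linearPullback,
    (mem_relativeCochains.1 hf).1, ev_zero]

/-- The cochain `f` vanishes on the tuples produced by splitting a tuple at its first `i` places
along the idempotents `p` and `q`. -/
structure VanishesAlong (p q : A) (n i : ℕ) (f : Cochain A n) : Prop where
  left : ∀ a, a 0 * p = a 0 → (∀ k, 0 < k → k < i → p * a k * p = a k) → p * a i = a i → ev f a = 0
  right : ∀ a, a 0 * q = a 0 → (∀ k, 0 < k → k < i → q * a k * q = a k) → q * a i = a i →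
    ev f a = 0
  mixed : ∀ a, a 0 * p = a 0 → q * a i = a i → ev f a = 0

/-- A pair of complementary idempotents `p`, `q` with `q A p = 0`. -/
structure IsTriangularPair (p q : A) : Prop where
  add_eq_one : p + q = 1
  mul_mul_eq_zero : ∀ x, q * x * p = 0

namespace IsTriangularPair

variable {p q : A} (h : IsTriangularPair p q)
include h

omit [NormedAlgebra ℂ A] in
theorem q_mul_p : q * p = 0 := by simpa using h.mul_mul_eq_zero 1

omit [NormedAlgebra ℂ A] in
theorem p_mul_p : p * p = p := by
  have := congrArg (· * p) h.add_eq_one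
  simpa [add_mul, h.q_mul_p] using this

omit [NormedAlgebra ℂ A] in
theorem q_mul_q : q * q = q := by
  have := congrArg (q * ·) h.add_eq_one
  simpa [mul_add, h.q_mul_p] using this

omit [NormedAlgebra ℂ A] in
theorem p_mul_q : p * q = 0 := by
  have := congrArg (p * ·) h.add_eq_one
  simpa [mul_add, h.p_mul_p] using this

/-- Inserting `p + q = 1` between `x` and `y`, the `q` term contains `q y p = 0`. -/
theorem corner_p_mul (x y : A) : corner p (x * y) = corner p x * corner p y := by
  simp only [corner_apply]
  calc p * (x * y) * p = p * x * ((p + q) * y * p) := by rw [h.add_eq_one]; noncomm_ring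
    _ = p * x * (p * y * p) := by rw [add_mul, add_mul, h.mul_mul_eq_zero, add_zero]
    _ = p * x * p * (p * y * p) := by
      conv_lhs => rw [← h.p_mul_p]
      simp only [mul_assoc, h.p_mul_p]
      simp only [← mul_assoc, h.p_mul_p]

theorem corner_q_mul (x y : A) : corner q (x * y) = corner q x * corner q y := by
  simp only [corner_apply]
  calc q * (x * y) * q = q * x * (p + q) * (y * q) := by rw [h.add_eq_one]; noncomm_ring
    _ = q * x * q * (y * q) := by rw [mul_add, h.mul_mul_eq_zero, zero_add]
    _ = q * x * (q * q) * (y * q) := by rw [h.q_mul_q]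
    _ = q * x * q * (q * y * q) := by noncomm_ring

theorem coface_mem (n i : ℕ) (f : Cochain A n) (hf : f ∈ relativeCochains p q n) :
    coface A n i f ∈ relativeCochains p q (n + 1) := by
  rw [mem_relativeCochains] at hf ⊢
  rw [← coface_linearPullback _ h.corner_p_mul, ← coface_linearPullback _ h.corner_q_mul,
    hf.1, hf.2, map_zero]
  exact ⟨rfl, rfl⟩

omit h in
theorem cyclicOperator_mem (n : ℕ) (f : Cochain A n) (hf : f ∈ relativeCochains p q n) :
    cyclicOperator A n f ∈ relativeCochains p q n := by
  rw [mem_relativeCochains] at hf ⊢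
  rw [← cyclicOperator_linearPullback, ← cyclicOperator_linearPullback, hf.1, hf.2, map_zero]
  exact ⟨rfl, rfl⟩

/-- The compressions are idempotent and annihilate each other, so this formula projects onto the
relative cochains. It commutes with `b` and `b'`, hence turns arbitrary primitives of relative
cochains into relative ones. -/
theorem sub_mem (n : ℕ) (f : Cochain A n) :
    f - linearPullback (corner p) n f - linearPullback (corner q) n f ∈
      relativeCochains p q n := by
  rw [mem_relativeCochains]
  constructor <;>
  · refine ev_ext fun a => ?_
    simp only [map_sub, ev_sub, ev_linearPullback, ev_zero]
    first
    | rw [ev_eq_zero f (fun k => corner q (corner p (a k))) 0 (Nat.zero_le n) (by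
        simp only [corner_apply, ← mul_assoc, h.q_mul_p, zero_mul]), sub_zero, sub_eq_zero]
      refine ev_congr f fun k _ => ?_
      simp only [corner_apply, ← mul_assoc, h.p_mul_p]
      simp only [mul_assoc, h.p_mul_p]
    | rw [ev_eq_zero f (fun k => corner p (corner q (a k))) 0 (Nat.zero_le n) (by
        simp only [corner_apply, ← mul_assoc, h.p_mul_q, zero_mul]), sub_zero, sub_eq_zero]
      refine ev_congr f fun k _ => ?_
      simp only [corner_apply, ← mul_assoc, h.q_mul_q]
      simp only [mul_assoc, h.q_mul_q]

/-- The splitting operators given by `p ⊗ p + q ⊗ q`. -/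
def operators : SplittingOperators (coface A) :=
  splittingOperators (u := fun j : Bool => cond j p q) (v := fun j => cond j p q) (by
    simp [h.p_mul_p, h.q_mul_q, h.add_eq_one])

theorem ev_operators (n i : ℕ) (f : Cochain A n) (a : ℕ → A) :
    ev (h.operators.π n i f) a =
      ev f (multiplyPair n i p p a) + ev f (multiplyPair n i q q a) := by
  refine (ev_multiplySum _ _ n i f a).trans ?_
  simp

/-- `πₙ` closes the chain of idempotents by joining `aₙ` to `a₀`. If it continues the same
idempotent, the tuple lies in one corner, where `f` vanishes. Otherwise `aₙ` or `a₀` is replaced by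
an element of `q A p = 0`; for a mixed chain this happens with either choice. -/
theorem vanishesAlong_last (n : ℕ) (hn : 0 < n) (f : Cochain A n)
    (hf : f ∈ relativeCochains p q n) : VanishesAlong p q n n (h.operators.π n n f) := by
  have hpp := h.p_mul_p
  have hqq := h.q_mul_q
  have hqp := h.q_mul_p
  have hpq := h.p_mul_q
  have hqxp := h.mul_mul_eq_zero
  have hf' := hf
  rw [relativeCochains_swap] at hf'
  refine ⟨fun a h0 hk hi => ?_, fun a h0 hk hi => ?_, fun a h0 hi => ?_⟩
  · rw [ev_operators, ev_eq_zero_of_corner hf (multiplyPair n n p p a), zero_add,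
      ev_eq_zero f _ 0 (Nat.zero_le n)]
    · simp only [multiplyPair]
      grind
    · intro k hkn
      simp only [multiplyPair]
      grind
  · rw [ev_operators, ev_eq_zero_of_corner hf' (multiplyPair n n q q a), add_zero,
      ev_eq_zero f _ n le_rfl]
    · simp only [multiplyPair]
      grind
    · intro k hkn
      simp only [multiplyPair]
      grind
  · rw [ev_operators, ev_eq_zero f _ n le_rfl, zero_add, ev_eq_zero f _ 0 (Nat.zero_le n)]
    · simp only [multiplyPair]
      grind
    · simp only [multiplyPair]
      grind

/-- Each choice at place `i` prolongs the chain by one. A `p`-chain continues as a `p`-chain or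
becomes mixed; a chain that has reached `q` must stay there, because choosing `p` creates the entry
`q aᵢ p = 0`. -/
theorem vanishesAlong_π (n i : ℕ) (hi : 0 < i) (hin : i < n) (f : Cochain A n)
    (hf : VanishesAlong p q n (i + 1) f) : VanishesAlong p q n i (h.operators.π n i f) := by
  have hpp := h.p_mul_p
  have hqq := h.q_mul_q
  have hqp := h.q_mul_p
  have hpq := h.p_mul_q
  have hqxp := h.mul_mul_eq_zero
  refine ⟨fun a h0 hk hi => ?_, fun a h0 hk hi => ?_, fun a h0 hi => ?_⟩
  · rw [ev_operators, hf.left, hf.mixed, zero_add]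
    all_goals
      simp only [multiplyPair]
      grind
  · rw [ev_operators, hf.right (multiplyPair n i q q a), add_zero, ev_eq_zero f _ i hin.le]
    all_goals
      simp only [multiplyPair]
      grind
  · rw [ev_operators, hf.mixed (multiplyPair n i q q a), add_zero, ev_eq_zero f _ i hin.le]
    all_goals
      simp only [multiplyPair]
      grind

/-- The first split makes `a₀` end and `a₁` begin with the same idempotent, so the two summands
start a `p`-chain and a `q`-chain. -/
theorem π_zero_eq_zero (n : ℕ) (f : Cochain A n) (hf : VanishesAlong p q n 1 f) :
    h.operators.π n 0 f = 0 := by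
  have hpp := h.p_mul_p
  have hqq := h.q_mul_q
  refine ev_ext fun a => ?_
  rw [ev_operators, hf.left, hf.right, zero_add, ev_zero]
  all_goals
    simp only [multiplyPair]
    grind

theorem prodπ_eq_zero_of_vanishesAlong (n i : ℕ) (hin : i < n) (f : Cochain A n)
    (hf : VanishesAlong p q n (i + 1) f) : h.operators.prodπ n (i + 1) f = 0 := by
  induction i generalizing f with
  | zero =>
    rw [SplittingOperators.prodπ_succ, h.π_zero_eq_zero n f hf, map_zero]
  | succ i ih =>
    rw [SplittingOperators.prodπ_succ]
    exact ih (by omega) _ (h.vanishesAlong_π n (i + 1) (by omega) hin f hf)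

theorem prodπ_eq_zero (n : ℕ) (f : Cochain A n) (hf : f ∈ relativeCochains p q n) :
    h.operators.prodπ n (n + 1) f = 0 := by
  rw [SplittingOperators.prodπ_succ]
  cases n with
  | zero =>
    refine ev_ext fun a => ?_
    have hpp := h.p_mul_p
    have hqq := h.q_mul_q
    have hf' := hf
    rw [relativeCochains_swap] at hf'
    change ev (h.operators.π 0 0 f) a = _
    rw [ev_operators, ev_eq_zero_of_corner hf, ev_eq_zero_of_corner hf', zero_add, ev_zero]
    all_goals
      intro k hk
      simp only [multiplyPair]
      grind
  | succ n =>
    exact h.prodπ_eq_zero_of_vanishesAlong _ n (by omega) _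
      (h.vanishesAlong_last _ (by omega) f hf)

/-- The cocyclic space of cochains that vanish on the corners. -/
def relativeModule : CocyclicModule fun n => relativeCochains p q n :=
  (cochainModule A).restrict _ h.coface_mem cyclicOperator_mem

theorem exists_b_eq (n : ℕ) (f : relativeCochains p q (n + 1))
    (hf : h.relativeModule.b (n + 1) f = 0) : ∃ g, h.relativeModule.b n g = f := by
  have hb : coboundary (n + 1) (f : Cochain A (n + 1)) = 0 := by
    rw [← cochainModule_b, ← (cochainModule A).coe_restrict_b (relativeCochains p q) h.coface_mem
      cyclicOperator_mem]
    exact congrArg Subtype.val hf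
  have hh := h.operators.homotopy_succ n f
  have e1 : ∑ k ∈ Finset.range (n + 3), coface A (n + 1) k (f : Cochain A (n + 1)) = 0 := by
    rw [← hb, ← cochainModule_b, CocyclicModule.b_apply]
    rfl
  rw [e1, map_zero, h.prodπ_eq_zero _ _ f.2, sub_zero, eq_comm, sub_eq_zero] at hh
  have e2 : coboundary n (h.operators.homotopy n f) = f := by
    rw [← cochainModule_b, CocyclicModule.b_apply]
    exact hh.symm
  -- The homotopy gives a primitive among all cochains. Its relative projection is still a
  -- primitive, since the compressions of `f` are zero.
  refine ⟨⟨_, h.sub_mem n (h.operators.homotopy n f)⟩, Subtype.ext ?_⟩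
  refine ((cochainModule A).coe_restrict_b (relativeCochains p q) h.coface_mem
    cyclicOperator_mem n _).trans ?_
  rw [cochainModule_b]
  simp only [map_sub]
  rw [coboundary_linearPullback _ h.corner_p_mul, coboundary_linearPullback _ h.corner_q_mul, e2,
    (mem_relativeCochains.1 f.2).1, (mem_relativeCochains.1 f.2).2, sub_zero, sub_zero]

theorem eq_zero_of_b (f : relativeCochains p q 0) (hf : h.relativeModule.b 0 f = 0) : f = 0 := by
  have hb : coboundary 0 (f : Cochain A 0) = 0 := by
    rw [← cochainModule_b, ← (cochainModule A).coe_restrict_b (relativeCochains p q) h.coface_mem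
      cyclicOperator_mem]
    exact congrArg Subtype.val hf
  have hh := h.operators.homotopy_zero f
  have e1 : ∑ k ∈ Finset.range 2, coface A 0 k (f : Cochain A 0) = 0 := by
    rw [← hb, ← cochainModule_b, CocyclicModule.b_apply]
    rfl
  rw [e1, map_zero, h.prodπ_eq_zero _ _ f.2, sub_zero] at hh
  exact Subtype.ext hh.symm

theorem exists_relative_b'_eq (n : ℕ) (f : relativeCochains p q (n + 1))
    (hf : h.relativeModule.b' (n + 1) f = 0) : ∃ g, h.relativeModule.b' n g = f := by
  obtain ⟨g, hg⟩ := exists_b'_eq n (f : Cochain A (n + 1)) (by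
    rw [← (cochainModule A).coe_restrict_b' (relativeCochains p q) h.coface_mem cyclicOperator_mem]
    exact congrArg Subtype.val hf)
  refine ⟨⟨_, h.sub_mem n g⟩, Subtype.ext ?_⟩
  refine ((cochainModule A).coe_restrict_b' (relativeCochains p q) h.coface_mem
    cyclicOperator_mem n _).trans ?_
  simp only [map_sub]
  rw [b'_linearPullback _ h.corner_p_mul, b'_linearPullback _ h.corner_q_mul, hg,
    (mem_relativeCochains.1 f.2).1, (mem_relativeCochains.1 f.2).2, sub_zero, sub_zero]

/-- A cyclic cocycle that vanishes on both corners is the coboundary of a cyclic cochain. -/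
theorem mem_cyclicCoboundaries (n : ℕ) (f : Cochain A n) (hf : f ∈ cyclicCocycles A n)
    (hf' : f ∈ relativeCochains p q n) : f ∈ cyclicCoboundaries A n := by
  have hT := (mem_cyclicCochains_iff n f).1 hf.1
  have hb : h.relativeModule.b n ⟨f, hf'⟩ = 0 := Subtype.ext (by
    refine ((cochainModule A).coe_restrict_b (relativeCochains p q) h.coface_mem
      cyclicOperator_mem n _).trans ?_
    rw [cochainModule_b]
    exact hf.2)
  cases n with
  | zero => exact congrArg Subtype.val (h.eq_zero_of_b _ hb)
  | succ n =>
    obtain ⟨g, hgT, hg⟩ := h.relativeModule.cyclic_acyclic h.eq_zero_of_b h.exists_b_eq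
      (fun x hx => Subtype.ext (eq_zero_of_b' _ (by
        rw [← (cochainModule A).coe_restrict_b' (relativeCochains p q) h.coface_mem
          cyclicOperator_mem]
        exact congrArg Subtype.val hx)))
      h.exists_relative_b'_eq n ⟨f, hf'⟩ (Subtype.ext hT) hb
    refine ⟨g, (mem_cyclicCochains_iff n _).2 (congrArg Subtype.val hgT), ?_⟩
    rw [← cochainModule_b]
    exact ((cochainModule A).coe_restrict_b (relativeCochains p q) h.coface_mem
      cyclicOperator_mem n g).symm.trans (congrArg Subtype.val hg)

end IsTriangularPair

end Corners

/-! ### Passage to cohomology and the isomorphism for a triangular pair. -/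

section Continuity

variable {V W : Type*} [NormedAddCommGroup V] [NormedSpace ℂ V] [NormedAddCommGroup W]
  [NormedSpace ℂ W]

theorem Subquotient.mk_surjective (Z B : Submodule ℂ V) :
    Function.Surjective (Subquotient.mk Z B) :=
  Submodule.mkQ_surjective _

theorem Subquotient.mk_eq_mk_iff {Z B : Submodule ℂ V} {v w : Z} :
    Subquotient.mk Z B v = Subquotient.mk Z B w ↔ (v : V) - w ∈ B :=
  Submodule.Quotient.eq _

theorem Subquotient.continuous_map {Z B : Submodule ℂ V} {Z' B' : Submodule ℂ W} (f : V →L[ℂ] W)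
    (hZ : ∀ v ∈ Z, f v ∈ Z') (hB : ∀ v ∈ B, f v ∈ B') :
    Continuous (Subquotient.map f.toLinearMap hZ hB) := by
  refine (Submodule.isOpenQuotientMap_mkQ (B.comap Z.subtype)).isQuotientMap.continuous_iff.2 ?_
  exact (Submodule.isOpenQuotientMap_mkQ (B'.comap Z'.subtype)).continuous.comp
    ((f.continuous.comp continuous_subtype_val).subtype_mk fun v => hZ v v.2)

end Continuity

section Functoriality

variable {A B : Type*} [NormedRing A] [NormedAlgebra ℂ A] [NormedRing B] [NormedAlgebra ℂ B]

/-- The continuous map `HCⁿ(B) → HCⁿ(A)` induced by a continuous, multiplicative and not necessarily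
unital linear map `A → B`. -/
def HC.linearMap (n : ℕ) (L : A →L[ℂ] B) (hL : ∀ x y, L (x * y) = L x * L y) :
    HC B n →L[ℂ] HC A n where
  toLinearMap := Subquotient.map (linearPullback L n).toLinearMap
    (fun _ hf => linearPullback_mem_cyclicCocycles L hL n hf)
    fun _ hf => linearPullback_mem_cyclicCoboundaries L hL n hf
  cont := Subquotient.continuous_map _ _ _

theorem HC.linearMap_mk (n : ℕ) (L : A →L[ℂ] B) (hL : ∀ x y, L (x * y) = L x * L y)
    (f : cyclicCocycles B n) :
    HC.linearMap n L hL (Subquotient.mk _ _ f) =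
      Subquotient.mk _ _ ⟨linearPullback L n f, linearPullback_mem_cyclicCocycles L hL n f.2⟩ := rfl

variable {B' : Type*} [NormedRing B'] [NormedAlgebra ℂ B']

/-- If `A` has corners isomorphic to `B` and `B'`, complementary and triangular, then
`HCⁿ(A) ≅ HCⁿ(B) ⊕ HCⁿ(B')`. -/
def HC.triangularEquiv {p q : A} (h : IsTriangularPair p q) (n : ℕ)
    (r : A →L[ℂ] B) (r' : A →L[ℂ] B') (s : B →L[ℂ] A) (s' : B' →L[ℂ] A)
    (hr : ∀ x y, r (x * y) = r x * r y) (hr' : ∀ x y, r' (x * y) = r' x * r' y)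
    (hs : ∀ x y, s (x * y) = s x * s y) (hs' : ∀ x y, s' (x * y) = s' x * s' y)
    (hrs : ∀ x, r (s x) = x) (hrs' : ∀ x, r' (s' x) = x)
    (h0 : ∀ x, r (s' x) = 0) (h0' : ∀ x, r' (s x) = 0)
    (hsr : ∀ x, s (r x) = corner p x) (hsr' : ∀ x, s' (r' x) = corner q x) :
    (HC B n × HC B' n) ≃L[ℂ] HC A n :=
  ContinuousLinearEquiv.equivOfInverse
    ((HC.linearMap n r hr).coprod (HC.linearMap n r' hr'))
    ((HC.linearMap n s hs).prod (HC.linearMap n s' hs'))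
    (by
      rintro ⟨x, x'⟩
      obtain ⟨f, rfl⟩ := Subquotient.mk_surjective _ _ x
      obtain ⟨f', rfl⟩ := Subquotient.mk_surjective _ _ x'
      rw [ContinuousLinearMap.coprod_apply, linearMap_mk, linearMap_mk, ← map_add,
        ContinuousLinearMap.prod_apply, linearMap_mk, linearMap_mk]
      refine Prod.ext (congrArg (Subquotient.mk _ _) (Subtype.ext (ev_ext fun a => ?_)))
        (congrArg (Subquotient.mk _ _) (Subtype.ext (ev_ext fun a => ?_)))
      · change ev (f : Cochain B n) (fun k => r (s (a k))) +
          ev (f' : Cochain B' n) (fun k => r' (s (a k))) = _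
        rw [ev_eq_zero (f' : Cochain B' n) _ 0 (Nat.zero_le n) (h0' _), add_zero]
        simp only [hrs]
      · change ev (f : Cochain B n) (fun k => r (s' (a k))) +
          ev (f' : Cochain B' n) (fun k => r' (s' (a k))) = _
        rw [ev_eq_zero (f : Cochain B n) _ 0 (Nat.zero_le n) (h0 _), zero_add]
        simp only [hrs'])
    (by
      intro x
      obtain ⟨f, rfl⟩ := Subquotient.mk_surjective _ _ x
      rw [ContinuousLinearMap.prod_apply, ContinuousLinearMap.coprod_apply, linearMap_mk,
        linearMap_mk, linearMap_mk, linearMap_mk, ← map_add, eq_comm, Subquotient.mk_eq_mk_iff]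
      have e : linearPullback r n (linearPullback s n (f : Cochain A n)) =
          linearPullback (corner p) n (f : Cochain A n) :=
        ev_ext fun a => by simp only [ev_linearPullback, hsr]
      have e' : linearPullback r' n (linearPullback s' n (f : Cochain A n)) =
          linearPullback (corner q) n (f : Cochain A n) :=
        ev_ext fun a => by simp only [ev_linearPullback, hsr']
      rw [Submodule.coe_add]
      simp only [e, e', ← sub_sub]
      -- A cocycle and the sum of its two compressions differ by a relative cyclic cocycle, hence by
      -- a cyclic coboundary.
      refine h.mem_cyclicCoboundaries n _ ?_ (h.sub_mem n _)
      exact sub_mem (sub_mem f.2 (linearPullback_mem_cyclicCocycles _ h.corner_p_mul n f.2))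
        (linearPullback_mem_cyclicCocycles _ h.corner_q_mul n f.2))

end Functoriality

end BanachCyclic

/-! ### The diagonal inclusions and idempotents of the triangular algebra. -/

namespace Triangular

variable {A₁ Y A₂ : Type*} [NormedRing A₁] [NormedAlgebra ℂ A₁] [NormedRing A₂]
  [NormedAlgebra ℂ A₂] [NormedAddCommGroup Y] [NormedSpace ℂ Y] [Module A₁ Y] [Module A₂ᵐᵒᵖ Y]
  [SMulCommClass A₁ A₂ᵐᵒᵖ Y] [IsScalarTower ℂ A₁ Y] [IsScalarTower ℂ A₂ᵐᵒᵖ Y]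

variable (A₁ Y A₂) in
/-- The inclusion `r ↦ [[r, 0], [0, 0]]`. -/
def incl₁ : A₁ →L[ℂ] Triangular A₁ Y A₂ where
  toFun r := mk r 0 0
  map_add' _ _ := ext rfl (add_zero 0).symm (add_zero 0).symm
  map_smul' c _ := ext rfl (smul_zero c).symm (smul_zero c).symm
  cont := continuous_id.prodMk continuous_const

variable (A₁ Y A₂) in
/-- The inclusion `r ↦ [[0, 0], [0, r]]`. -/
def incl₂ : A₂ →L[ℂ] Triangular A₁ Y A₂ where
  toFun r := mk 0 0 r
  map_add' _ _ := ext (add_zero 0).symm (add_zero 0).symm rfl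
  map_smul' c _ := ext (smul_zero c).symm (smul_zero c).symm rfl
  cont := continuous_const.prodMk (continuous_const.prodMk continuous_id)

theorem e11_incl₁ (r : A₁) : (incl₁ A₁ Y A₂ r).e11 = r := rfl

theorem e12_incl₁ (r : A₁) : (incl₁ A₁ Y A₂ r).e12 = 0 := rfl

theorem e22_incl₁ (r : A₁) : (incl₁ A₁ Y A₂ r).e22 = 0 := rfl

theorem e11_incl₂ (r : A₂) : (incl₂ A₁ Y A₂ r).e11 = 0 := rfl

theorem e12_incl₂ (r : A₂) : (incl₂ A₁ Y A₂ r).e12 = 0 := rfl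

theorem e22_incl₂ (r : A₂) : (incl₂ A₁ Y A₂ r).e22 = r := rfl

theorem incl₁_mul (r s : A₁) : incl₁ A₁ Y A₂ (r * s) = incl₁ A₁ Y A₂ r * incl₁ A₁ Y A₂ s := by
  apply ext <;> simp [e11_mul, e12_mul, e22_mul, e11_incl₁, e12_incl₁, e22_incl₁]

theorem incl₂_mul (r s : A₂) : incl₂ A₁ Y A₂ (r * s) = incl₂ A₁ Y A₂ r * incl₂ A₁ Y A₂ s := by
  apply ext <;> simp [e11_mul, e12_mul, e22_mul, e11_incl₂, e12_incl₂, e22_incl₂]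

theorem incl_one_add_incl_one : incl₁ A₁ Y A₂ 1 + incl₂ A₁ Y A₂ 1 = 1 :=
  ext (add_zero 1) (add_zero 0) (zero_add 1)

theorem incl₂_one_mul_mul_incl₁_one (u : Triangular A₁ Y A₂) :
    incl₂ A₁ Y A₂ 1 * u * incl₁ A₁ Y A₂ 1 = 0 := by
  apply ext <;> simp [e11_mul, e12_mul, e22_mul, e11_zero, e12_zero, e22_zero, e11_incl₁,
    e12_incl₁, e22_incl₁, e11_incl₂, e12_incl₂, e22_incl₂]

theorem incl₁_e11 (u : Triangular A₁ Y A₂) :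
    incl₁ A₁ Y A₂ u.e11 = incl₁ A₁ Y A₂ 1 * u * incl₁ A₁ Y A₂ 1 := by
  apply ext <;> simp [e11_mul, e12_mul, e22_mul, e11_incl₁, e12_incl₁, e22_incl₁]

theorem incl₂_e22 (u : Triangular A₁ Y A₂) :
    incl₂ A₁ Y A₂ u.e22 = incl₂ A₁ Y A₂ 1 * u * incl₂ A₁ Y A₂ 1 := by
  apply ext <;> simp [e11_mul, e12_mul, e22_mul, e11_incl₂, e12_incl₂, e22_incl₂]

end Triangular

end

theorem proposition4p7 {A₁ A₂ Y U : Type*}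
    [NormedRing A₁] [NormedAlgebra ℂ A₁] [CompleteSpace A₁]
    [NormedRing A₂] [NormedAlgebra ℂ A₂] [CompleteSpace A₂]
    [NormedAddCommGroup Y] [NormedSpace ℂ Y] [CompleteSpace Y]
    [Module A₁ Y] [Module A₂ᵐᵒᵖ Y] [SMulCommClass A₁ A₂ᵐᵒᵖ Y]
    [IsScalarTower ℂ A₁ Y] [IsScalarTower ℂ A₂ᵐᵒᵖ Y]
    [ContinuousSMul A₁ Y] [ContinuousSMul A₂ᵐᵒᵖ Y]
    [NormedRing U] [NormedAlgebra ℂ U] [CompleteSpace U]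
    (φ : U ≃A[ℂ] Triangular A₁ Y A₂) (n : ℕ) :
    ∃ e : (BanachCyclic.HC A₁ n × BanachCyclic.HC A₂ n) ≃L[ℂ] BanachCyclic.HC U n,
      ∀ (x₁ : BanachCyclic.HC A₁ n) (x₂ : BanachCyclic.HC A₂ n),
        e (x₁, x₂) =
          BanachCyclic.HC.map n ((Triangular.proj₁ A₁ Y A₂).comp φ.toContinuousAlgHom) x₁ +
          BanachCyclic.HC.map n ((Triangular.proj₂ A₁ Y A₂).comp φ.toContinuousAlgHom) x₂ := by
  let ψ := φ.symm.toContinuousAlgHom.toContinuousLinearMap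
  have hψ : ∀ u v, ψ (u * v) = ψ u * ψ v := fun u v => map_mul φ.symm u v
  have hφψ : ∀ u, φ (ψ u) = u := φ.apply_symm_apply
  have hψφ : ∀ u, ψ (φ u) = u := φ.symm_apply_apply
  -- The idempotents are the diagonal matrix units, carried to `U` by the inverse of `φ`.
  have h : BanachCyclic.IsTriangularPair (ψ (Triangular.incl₁ A₁ Y A₂ 1))
      (ψ (Triangular.incl₂ A₁ Y A₂ 1)) := by
    refine ⟨?_, fun x => ?_⟩
    · rw [← map_add, Triangular.incl_one_add_incl_one]
      exact map_one φ.symm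
    · rw [← hψφ x, ← hψ, ← hψ, Triangular.incl₂_one_mul_mul_incl₁_one, map_zero]
  refine ⟨BanachCyclic.HC.triangularEquiv h n
    ((Triangular.proj₁ A₁ Y A₂).comp φ.toContinuousAlgHom).toContinuousLinearMap
    ((Triangular.proj₂ A₁ Y A₂).comp φ.toContinuousAlgHom).toContinuousLinearMap
    (ψ ∘L Triangular.incl₁ A₁ Y A₂) (ψ ∘L Triangular.incl₂ A₁ Y A₂)
    (map_mul ((Triangular.proj₁ A₁ Y A₂).comp φ.toContinuousAlgHom))
    (map_mul ((Triangular.proj₂ A₁ Y A₂).comp φ.toContinuousAlgHom))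
    (fun x y => ?_) (fun x y => ?_) (fun x => ?_) (fun x => ?_) (fun x => ?_) (fun x => ?_)
    (fun x => ?_) (fun x => ?_), fun x₁ x₂ => rfl⟩
  · exact (congrArg ψ (Triangular.incl₁_mul x y)).trans (hψ _ _)
  · exact (congrArg ψ (Triangular.incl₂_mul x y)).trans (hψ _ _)
  · exact congrArg Triangular.e11 (hφψ (Triangular.incl₁ A₁ Y A₂ x))
  · exact congrArg Triangular.e22 (hφψ (Triangular.incl₂ A₁ Y A₂ x))
  · exact congrArg Triangular.e11 (hφψ (Triangular.incl₂ A₁ Y A₂ x))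
  · exact congrArg Triangular.e22 (hφψ (Triangular.incl₁ A₁ Y A₂ x))
  · change ψ (Triangular.incl₁ A₁ Y A₂ (φ x).e11) = _
    rw [Triangular.incl₁_e11, hψ, hψ, hψφ]
    rfl
  · change ψ (Triangular.incl₂ A₁ Y A₂ (φ x).e22) = _
    rw [Triangular.incl₂_e22, hψ, hψ, hψφ]
    rfl
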